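/- Let $p$ be a prime, $k=\mathbb F_q$ a finite field of characteristic $p$ with $q$ elements, and $\sigma$ the $p$-power Frobenius of $k$, as well as its lift to $W(k)$. For $g\ge 0$ let $D=W(k)^{2g}$ with its standard symplectic form $\omega$, and let $\overline{D}=D/pD=\mathbb F_q^{2g}$ with the induced form $\overline\omega$. A $\sigma$-semilinear endomorphism $F_0$ of $D$ is called *$p$-autodual* if there is a $\sigma^{-1}$-semilinear endomorphism $V_0$ of $D$ with $F_0V_0=V_0F_0=p$ and $\omega(F_0x,y)=\sigma(\omega(x,V_0y))$ for all $x,y\in D$. Such $F_0$ exist; fix one for each $g$, and let $\overline{F}_0$ be its reduction modulo $p$. A *principally quasi-polarized (pqp) $\mathrm{DBT}_1$* over $k$ is a finite-dimensional $k$-vector space $W$ with a $\sigma$-semilinear map $F$, a $\sigma^{-1}$-semilinear map $V$ and a nondegenerate alternating form $\omega_W$ such that $\operatorname{im}F=\ker V$, $\operatorname{im}V=\ker F$ and $\omega_W(Fx,y)=\sigma(\omega_W(x,Vy))$ for all $x,y \in W$. The *random pqp $\mathrm{DBT}_1$ of dimension $2g$* is $(\overline D,F,V,\overline\omega)$ with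 $F=A\overline{F}_0B$, where $(A,B)$ is uniformly distributed in $\mathrm{Sp}(\overline D)\times\mathrm{Sp}(\overline D)$, and $V$ is determined by $F$ and $\overline\omega$. For a pqp $\mathrm{DBT}_1$ of dimension $2g$ the *$a$-number* is $\dim_k(\ker F\cap\ker V)$, and the *$p$-corank* is $g-f$, where the $p$-rank $f$ is the dimension of the largest subspace on which $F$ is bijective. Then for all integers $0\le r\le s$ (and for every choice of the $F_0$) the probability that the random pqp $\mathrm{DBT}_1$ of dimension $2g$ has $a$-number $r$ and $p$-corank $s$ converges, as $g\to\infty$, to $$q^{-\binom{r+1}{2}+r-s}\ \prod_{i=1}^\infty(1+q^{-i})^{-1}\ \prod_{i=r}^{s-1}(1-q^{-i})\ \prod_{i=1}^{s-r}(1-q^{-i})^{-1}.$$ -/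

import Mathlib

set_option linter.unusedSectionVars false

noncomputable section

namespace RandomDBT

/-- The `p`-power Frobenius automorphism `σ` of the finite field `k`. -/
abbrev sigma (p : ℕ) [Fact p.Prime] (k : Type*) [Field k] [Finite k] [CharP k p] : k →+* k :=
  (frobeniusEquiv k p : k →+* k)

/-- The inverse `σ⁻¹` of the Frobenius automorphism of `k`. -/
abbrev sigmaInv (p : ℕ) [Fact p.Prime] (k : Type*) [Field k] [Finite k] [CharP k p] : k →+* k :=
  ((frobeniusEquiv k p).symm : k →+* k)

/-- The Frobenius automorphism `σ` of the ring of Witt vectors `ℤ_q = W(k)`. -/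
abbrev sigmaW (p : ℕ) [Fact p.Prime] (k : Type*) [Field k] [Finite k] [CharP k p] :
    WittVector p k →+* WittVector p k :=
  (WittVector.frobeniusEquiv p k : WittVector p k →+* WittVector p k)

/-- The inverse `σ⁻¹` of the Frobenius automorphism of `W(k)`. -/
abbrev sigmaInvW (p : ℕ) [Fact p.Prime] (k : Type*) [Field k] [Finite k] [CharP k p] :
    WittVector p k →+* WittVector p k :=
  ((WittVector.frobeniusEquiv p k).symm : WittVector p k →+* WittVector p k)

/-- The standard symplectic form `ω(x, y) = ∑ i, (x i * y (g + i) - x (g + i) * y i)` on `R ^ (2g)`;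
the index set is `Fin g ⊕ Fin g`. -/
def stdForm (R : Type*) [CommRing R] (g : ℕ) : LinearMap.BilinForm R (Fin g ⊕ Fin g → R) :=
  LinearMap.mk₂ R
    (fun x y => ∑ i : Fin g, (x (Sum.inl i) * y (Sum.inr i) - x (Sum.inr i) * y (Sum.inl i)))
    (fun x x' y => by
      rw [← Finset.sum_add_distrib]
      exact Finset.sum_congr rfl fun i _ => by simp only [Pi.add_apply]; ring)
    (fun c x y => by
      rw [smul_eq_mul, Finset.mul_sum]
      exact Finset.sum_congr rfl fun i _ => by simp only [Pi.smul_apply, smul_eq_mul]; ring)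
    (fun x y y' => by
      rw [← Finset.sum_add_distrib]
      exact Finset.sum_congr rfl fun i _ => by simp only [Pi.add_apply]; ring)
    (fun c x y => by
      rw [smul_eq_mul, Finset.mul_sum]
      exact Finset.sum_congr rfl fun i _ => by simp only [Pi.smul_apply, smul_eq_mul]; ring)

theorem stdForm_apply (R : Type*) [CommRing R] (g : ℕ) (x y : Fin g ⊕ Fin g → R) :
    stdForm R g x y =
      ∑ i : Fin g, (x (Sum.inl i) * y (Sum.inr i) - x (Sum.inr i) * y (Sum.inl i)) := rfl

theorem stdForm_isAlt (R : Type*) [CommRing R] (g : ℕ) : (stdForm R g).IsAlt := by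
  intro x
  rw [stdForm_apply]
  exact Finset.sum_eq_zero fun i _ => by ring

theorem stdForm_nondegenerate (k : Type*) [Field k] (g : ℕ) : (stdForm k g).Nondegenerate := by
  have key : ∀ x, (∀ y, stdForm k g x y = 0) → x = 0 := by
    intro x hx
    funext j
    rcases j with i | i
    · simpa [stdForm_apply, Pi.single_apply] using hx (Pi.single (Sum.inr i) 1)
    · simpa [stdForm_apply, Pi.single_apply] using hx (Pi.single (Sum.inl i) 1)
  refine ⟨key, fun x hx => key x fun y => ?_⟩
  rw [← (stdForm_isAlt k g).neg_eq, hx y, neg_zero]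

/-- The symplectic group of a form `ω` on `W`: the linear automorphisms that preserve `ω`. -/
def Sp {k W : Type*} [Field k] [AddCommGroup W] [Module k W] (ω : LinearMap.BilinForm k W) :
    Subgroup (W ≃ₗ[k] W) where
  carrier := {A | ∀ x y, ω (A x) (A y) = ω x y}
  one_mem' := fun _ _ => rfl
  mul_mem' := fun {A B} hA hB x y => by
    rw [LinearEquiv.mul_apply, LinearEquiv.mul_apply, hA, hB]
  inv_mem' := fun {A} hA x y => by
    have h := hA (A⁻¹ x) (A⁻¹ y)
    rw [← LinearEquiv.mul_apply, ← LinearEquiv.mul_apply, mul_inv_cancel] at h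
    exact h.symm

section

variable (p : ℕ) [Fact p.Prime] (k : Type*) [Field k] [Finite k] [CharP k p]

/-- A principally quasi-polarized Dieudonné module `(D, F, V, ω)` of rank `2g` over `W(k)`,
on the free module `D = W(k) ^ (2g)` with its standard symplectic form. In other words, `F` is a
`p`-autodual `σ`-endomorphism of `D`. -/
structure PQPDieudonne (g : ℕ) where
  F : (Fin g ⊕ Fin g → WittVector p k) →ₛₗ[sigmaW p k] (Fin g ⊕ Fin g → WittVector p k)
  V : (Fin g ⊕ Fin g → WittVector p k) →ₛₗ[sigmaInvW p k] (Fin g ⊕ Fin g → WittVector p k)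
  F_V : ∀ x, F (V x) = (p : WittVector p k) • x
  V_F : ∀ x, V (F x) = (p : WittVector p k) • x
  form_F : ∀ x y, stdForm (WittVector p k) g (F x) y =
    sigmaW p k (stdForm (WittVector p k) g x (V y))

/-- A principally quasi-polarized `DBT₁` with underlying `k`-vector space `W`: a `σ`-semilinear `F`
and a `σ⁻¹`-semilinear `V` with `im F = ker V` and `im V = ker F` (so that `F V = V F = 0`), and a
symplectic form `ω` with `ω (F x, y) = σ (ω (x, V y))`. -/
structure PQPDBT1 (W : Type*) [AddCommGroup W] [Module k W] where
  F : W →ₛₗ[sigma p k] W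
  V : W →ₛₗ[sigmaInv p k] W
  ω : LinearMap.BilinForm k W
  isAlt : ω.IsAlt
  nondegenerate : ω.Nondegenerate
  range_F : LinearMap.range F = LinearMap.ker V
  range_V : LinearMap.range V = LinearMap.ker F
  form_F : ∀ x y, ω (F x) y = sigma p k (ω x (V y))

end

namespace PQPDBT1

variable {p : ℕ} [Fact p.Prime] {k : Type*} [Field k] [Finite k] [CharP k p]
variable {W : Type*} [AddCommGroup W] [Module k W]

/-- The `a`-number: the dimension of `ker F ∩ ker V`. -/
def aNumber (M : PQPDBT1 p k W) : ℕ :=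
  Module.finrank k (LinearMap.ker M.F ⊓ LinearMap.ker M.V : Submodule k W)

/-- The `p`-rank: the dimension of the largest subspace of `W` on which `F` is bijective. -/
def pRank (M : PQPDBT1 p k W) : ℕ :=
  Module.finrank k (sSup {U : Submodule k W | Set.BijOn M.F U U} : Submodule k W)

/-- The `p`-corank `g - f`, where `2g` is the dimension of `W` and `f ≤ g` is the `p`-rank. -/
def pCorank (M : PQPDBT1 p k W) : ℕ :=
  Module.finrank k W / 2 - M.pRank

/-- The principally quasi-polarized `DBT₁` with Frobenius `A F B`, for symplectic automorphisms
`A` and `B` of `W`. Its `V` is the only one compatible with `A F B` and `ω`. -/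
def translate (M : PQPDBT1 p k W) (A B : Sp M.ω) : PQPDBT1 p k W where
  F := ((A : W ≃ₗ[k] W) : W →ₗ[k] W).comp (M.F.comp ((B : W ≃ₗ[k] W) : W →ₗ[k] W))
  V := (((B : W ≃ₗ[k] W)⁻¹ : W ≃ₗ[k] W) : W →ₗ[k] W).comp
    (M.V.comp (((A : W ≃ₗ[k] W)⁻¹ : W ≃ₗ[k] W) : W →ₗ[k] W))
  ω := M.ω
  isAlt := M.isAlt
  nondegenerate := M.nondegenerate
  range_F := by
    ext y
    have h := SetLike.ext_iff.mp M.range_F ((A : W ≃ₗ[k] W)⁻¹ y)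
    simp only [LinearMap.mem_range, LinearMap.mem_ker] at h
    simp only [LinearMap.mem_range, LinearMap.mem_ker, LinearMap.comp_apply,
      LinearEquiv.coe_coe, map_eq_zero_iff _ (LinearEquiv.injective _), ← h]
    constructor
    · rintro ⟨x, rfl⟩
      exact ⟨(B : W ≃ₗ[k] W) x, ((A : W ≃ₗ[k] W).symm_apply_apply _).symm⟩
    · rintro ⟨x, hx⟩
      refine ⟨(B : W ≃ₗ[k] W)⁻¹ x, ?_⟩
      rw [show (B : W ≃ₗ[k] W) ((B : W ≃ₗ[k] W)⁻¹ x) = x from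
        (B : W ≃ₗ[k] W).apply_symm_apply x, hx]
      exact (A : W ≃ₗ[k] W).apply_symm_apply y
  range_V := by
    ext y
    have h := SetLike.ext_iff.mp M.range_V ((B : W ≃ₗ[k] W) y)
    simp only [LinearMap.mem_range, LinearMap.mem_ker] at h
    simp only [LinearMap.mem_range, LinearMap.mem_ker, LinearMap.comp_apply,
      LinearEquiv.coe_coe, map_eq_zero_iff _ (LinearEquiv.injective _), ← h]
    constructor
    · rintro ⟨x, rfl⟩
      exact ⟨(A : W ≃ₗ[k] W)⁻¹ x, ((B : W ≃ₗ[k] W).apply_symm_apply _).symm⟩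
    · rintro ⟨x, hx⟩
      refine ⟨(A : W ≃ₗ[k] W) x, ?_⟩
      rw [show (A : W ≃ₗ[k] W)⁻¹ ((A : W ≃ₗ[k] W) x) = x from
        (A : W ≃ₗ[k] W).symm_apply_apply x, hx]
      exact (B : W ≃ₗ[k] W).symm_apply_apply y
  form_F := by
    intro x y
    have hA := (A⁻¹).2
    have hB := B.2
    simp only [LinearMap.comp_apply, LinearEquiv.coe_coe]
    have h1 := hA ((A : W ≃ₗ[k] W) (M.F ((B : W ≃ₗ[k] W) x))) y
    rw [show ((A⁻¹ : Sp M.ω) : W ≃ₗ[k] W) ((A : W ≃ₗ[k] W) (M.F ((B : W ≃ₗ[k] W) x))) =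
      M.F ((B : W ≃ₗ[k] W) x) from (A : W ≃ₗ[k] W).symm_apply_apply _] at h1
    rw [← h1, M.form_F]
    have h2 := hB x ((B : W ≃ₗ[k] W)⁻¹ (M.V ((A : W ≃ₗ[k] W)⁻¹ y)))
    rw [show (B : W ≃ₗ[k] W) ((B : W ≃ₗ[k] W)⁻¹ (M.V ((A : W ≃ₗ[k] W)⁻¹ y))) =
      M.V ((A : W ≃ₗ[k] W)⁻¹ y) from (B : W ≃ₗ[k] W).apply_symm_apply _] at h2
    rw [← h2]
    rfl

end PQPDBT1

namespace PQPDieudonne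

variable {p : ℕ} [Fact p.Prime] {k : Type*} [Field k] [Finite k] [CharP k p] {g : ℕ}

/-- Reduction modulo `p`, from `D = W(k) ^ (2g)` to `D / pD = k ^ (2g)`. -/
def red (x : Fin g ⊕ Fin g → WittVector p k) : Fin g ⊕ Fin g → k :=
  fun i => WittVector.constantCoeff (x i)

/-- The coordinatewise Teichmüller lift from `k ^ (2g)` to `W(k) ^ (2g)`. -/
def lift (x : Fin g ⊕ Fin g → k) : Fin g ⊕ Fin g → WittVector p k :=
  fun i => WittVector.teichmuller p (x i)

theorem red_lift (x : Fin g ⊕ Fin g → k) : red (p := p) (lift x) = x :=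
  funext fun i => WittVector.teichmuller_coeff_zero p (x i)

theorem red_add (x y : Fin g ⊕ Fin g → WittVector p k) : red (x + y) = red x + red y :=
  funext fun _ => map_add WittVector.constantCoeff _ _

theorem red_sub (x y : Fin g ⊕ Fin g → WittVector p k) : red (x - y) = red x - red y :=
  funext fun _ => map_sub WittVector.constantCoeff _ _

theorem red_smul (c : WittVector p k) (x : Fin g ⊕ Fin g → WittVector p k) :
    red (c • x) = WittVector.constantCoeff c • red x :=
  funext fun _ => map_mul WittVector.constantCoeff _ _

theorem red_p_smul (x : Fin g ⊕ Fin g → WittVector p k) :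
    red ((p : WittVector p k) • x) = 0 := by
  rw [red_smul, map_natCast, CharP.cast_eq_zero, zero_smul]

/-- The kernel of the reduction map is `pD`. -/
theorem red_eq_zero_iff (x : Fin g ⊕ Fin g → WittVector p k) :
    red x = 0 ↔ ∃ z, x = (p : WittVector p k) • z := by
  constructor
  · intro h
    have hz : ∀ i, ∃ z, x i = (p : WittVector p k) * z := by
      intro i
      have h0 : (x i).coeff 0 = 0 := congrFun h i
      have hv := WittVector.verschiebung_shift (x i) 0 (fun j hj => by
        obtain rfl : j = 0 := by omega
        exact h0)
      obtain ⟨w, hw⟩ := (WittVector.frobenius_bijective p k).2 ((x i).shift 1)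
      refine ⟨w, ?_⟩
      have hx : x i = WittVector.verschiebung ((x i).shift 1) := by
        ext n
        cases n with
        | zero => rw [h0, WittVector.verschiebung_coeff_zero]
        | succ n =>
          rw [WittVector.verschiebung_coeff_succ, WittVector.shift_coeff, Nat.add_comm]
      rw [hx, ← hw, WittVector.verschiebung_frobenius, mul_comm]
    choose z hz using hz
    exact ⟨z, funext hz⟩
  · rintro ⟨z, rfl⟩
    exact red_p_smul z

theorem red_form (x y : Fin g ⊕ Fin g → WittVector p k) :
    WittVector.constantCoeff (stdForm (WittVector p k) g x y) = stdForm k g (red x) (red y) := by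
  simp only [stdForm_apply, map_sum, map_sub, map_mul, red]

theorem red_sigmaW (c : WittVector p k) :
    WittVector.constantCoeff (sigmaW p k c) = sigma p k (WittVector.constantCoeff c) :=
  WittVector.coeff_frobenius_charP (p := p) c 0

theorem red_sigmaInvW (c : WittVector p k) :
    WittVector.constantCoeff (sigmaInvW p k c) = sigmaInv p k (WittVector.constantCoeff c) := by
  apply (frobeniusEquiv k p).injective
  have h := red_sigmaW (p := p) (sigmaInvW p k c)
  have e1 : sigmaW p k (sigmaInvW p k c) = c := (WittVector.frobeniusEquiv p k).apply_symm_apply c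
  rw [e1] at h
  exact h.symm.trans ((frobeniusEquiv k p).apply_symm_apply _).symm

/-- A semilinear endomorphism of `D` is compatible with reduction modulo `p`. -/
theorem red_map_congr {τ : WittVector p k →+* WittVector p k}
    (f : (Fin g ⊕ Fin g → WittVector p k) →ₛₗ[τ] (Fin g ⊕ Fin g → WittVector p k))
    {x y : Fin g ⊕ Fin g → WittVector p k} (h : red x = red y) : red (f x) = red (f y) := by
  obtain ⟨z, hz⟩ := (red_eq_zero_iff (x - y)).1 (by rw [red_sub, h, sub_self])
  have h1 : red (f x - f y) = 0 := by
    rw [← map_sub, hz, map_smulₛₗ, map_natCast, red_p_smul]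
  rw [red_sub] at h1
  exact sub_eq_zero.1 h1

/-- The reduction modulo `p` of a semilinear endomorphism of `D`. -/
def redMap {τ : WittVector p k →+* WittVector p k} {t : k →+* k}
    (hτ : ∀ c, WittVector.constantCoeff (τ c) = t (WittVector.constantCoeff c))
    (f : (Fin g ⊕ Fin g → WittVector p k) →ₛₗ[τ] (Fin g ⊕ Fin g → WittVector p k)) :
    (Fin g ⊕ Fin g → k) →ₛₗ[t] (Fin g ⊕ Fin g → k) where
  toFun x := red (f (lift x))
  map_add' x y := by
    rw [← red_add, ← map_add]
    exact red_map_congr f (by rw [red_add, red_lift, red_lift, red_lift])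
  map_smul' c x := by
    have hc : WittVector.constantCoeff (WittVector.teichmuller p c) = c :=
      WittVector.teichmuller_coeff_zero p c
    have h := red_map_congr f (x := lift (c • x)) (y := WittVector.teichmuller p c • lift x)
      (by rw [red_smul, red_lift, red_lift, hc])
    rw [h, map_smulₛₗ, red_smul, hτ, hc]

theorem redMap_red {τ : WittVector p k →+* WittVector p k} {t : k →+* k}
    (hτ : ∀ c, WittVector.constantCoeff (τ c) = t (WittVector.constantCoeff c))
    (f : (Fin g ⊕ Fin g → WittVector p k) →ₛₗ[τ] (Fin g ⊕ Fin g → WittVector p k))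
    (x : Fin g ⊕ Fin g → WittVector p k) : redMap hτ f (red x) = red (f x) :=
  red_map_congr f (red_lift _)

theorem p_smul_injective {x y : Fin g ⊕ Fin g → WittVector p k}
    (h : (p : WittVector p k) • x = (p : WittVector p k) • y) : x = y :=
  funext fun i => mul_left_cancel₀ (WittVector.p_nonzero p k) (congrFun h i)

/-- The reduction `(D / pD, F mod p, V mod p, ω mod p)` modulo `p` of a principally quasi-polarized
Dieudonné module, as a principally quasi-polarized `DBT₁`. -/
def reduction (M : PQPDieudonne p k g) : PQPDBT1 p k (Fin g ⊕ Fin g → k) where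
  F := redMap red_sigmaW M.F
  V := redMap red_sigmaInvW M.V
  ω := stdForm k g
  isAlt := stdForm_isAlt k g
  nondegenerate := stdForm_nondegenerate k g
  range_F := by
    ext y
    obtain ⟨y, rfl⟩ : ∃ y', y = red (p := p) y' := ⟨lift y, (red_lift y).symm⟩
    simp only [LinearMap.mem_range, LinearMap.mem_ker, redMap_red]
    constructor
    · rintro ⟨x, hx⟩
      rw [← redMap_red red_sigmaInvW M.V, ← hx]
      change redMap red_sigmaInvW M.V (red (M.F (lift x))) = 0
      rw [redMap_red, M.V_F, red_p_smul]
    · intro h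
      obtain ⟨z, hz⟩ := (red_eq_zero_iff _).1 h
      refine ⟨red z, ?_⟩
      rw [redMap_red]
      congr 1
      apply p_smul_injective
      rw [← M.F_V y, hz, map_smulₛₗ, map_natCast]
  range_V := by
    ext y
    obtain ⟨y, rfl⟩ : ∃ y', y = red (p := p) y' := ⟨lift y, (red_lift y).symm⟩
    simp only [LinearMap.mem_range, LinearMap.mem_ker, redMap_red]
    constructor
    · rintro ⟨x, hx⟩
      rw [← redMap_red red_sigmaW M.F, ← hx]
      change redMap red_sigmaW M.F (red (M.V (lift x))) = 0
      rw [redMap_red, M.F_V, red_p_smul]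
    · intro h
      obtain ⟨z, hz⟩ := (red_eq_zero_iff _).1 h
      refine ⟨red z, ?_⟩
      rw [redMap_red]
      congr 1
      apply p_smul_injective
      rw [← M.V_F y, hz, map_smulₛₗ, map_natCast]
  form_F := by
    intro x y
    obtain ⟨x, rfl⟩ : ∃ x', x = red (p := p) x' := ⟨lift x, (red_lift x).symm⟩
    obtain ⟨y, rfl⟩ : ∃ y', y = red (p := p) y' := ⟨lift y, (red_lift y).symm⟩
    rw [redMap_red, redMap_red, ← red_form, ← red_form, M.form_F, red_sigmaW]

theorem sigmaW_sigmaInvW (c : WittVector p k) : sigmaW p k (sigmaInvW p k c) = c :=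
  (WittVector.frobeniusEquiv p k).apply_symm_apply c

theorem sigmaInvW_sigmaW (c : WittVector p k) : sigmaInvW p k (sigmaW p k c) = c :=
  (WittVector.frobeniusEquiv p k).symm_apply_apply c

/-- The random principally quasi-polarized `DBT₁` of dimension `2g`: the Frobenius is `A F₀ B`, where
`F₀` is the reduction modulo `p` of a `p`-autodual endomorphism of `D = W(k) ^ (2g)` and the pair
`(A, B)` is uniformly distributed in `Sp(D / pD) × Sp(D / pD)`. This is the probability that the
random `DBT₁` has the property `P`. -/
def prob (M₀ : PQPDieudonne p k g) (P : PQPDBT1 p k (Fin g ⊕ Fin g → k) → Prop) : ℝ :=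
  (Nat.card {AB : Sp (stdForm k g) × Sp (stdForm k g) //
      P (M₀.reduction.translate AB.1 AB.2)} : ℝ) /
    (Nat.card (Sp (stdForm k g) × Sp (stdForm k g)) : ℝ)

end PQPDieudonne

/-- The standard `p`-autodual endomorphism: `F e_i = e_i` and `F e_{g+i} = p e_{g+i}`, and
`V e_i = p e_i` and `V e_{g+i} = e_{g+i}`, for `1 ≤ i ≤ g`. -/
def PQPDieudonne.standard (p : ℕ) [Fact p.Prime] (k : Type*) [Field k] [Finite k] [CharP k p] (g : ℕ) :
    PQPDieudonne p k g where
  F :=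
    { toFun := fun x => Sum.elim (fun i => sigmaW p k (x (Sum.inl i)))
        (fun i => p * sigmaW p k (x (Sum.inr i)))
      map_add' := fun x y => by
        funext j; rcases j with i | i <;> simp [mul_add]
      map_smul' := fun c x => by
        funext j; rcases j with i | i <;> simp [mul_left_comm] }
  V :=
    { toFun := fun x => Sum.elim (fun i => p * sigmaInvW p k (x (Sum.inl i)))
        (fun i => sigmaInvW p k (x (Sum.inr i)))
      map_add' := fun x y => by
        funext j; rcases j with i | i <;> simp [mul_add]
      map_smul' := fun c x => by
        funext j; rcases j with i | i <;> simp [mul_left_comm] }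
  F_V := fun x => by
    funext j
    rcases j with i | i
    · change sigmaW p k (p * sigmaInvW p k (x (Sum.inl i))) = p * x (Sum.inl i)
      rw [map_mul, map_natCast, PQPDieudonne.sigmaW_sigmaInvW]
    · change p * sigmaW p k (sigmaInvW p k (x (Sum.inr i))) = p * x (Sum.inr i)
      rw [PQPDieudonne.sigmaW_sigmaInvW]
  V_F := fun x => by
    funext j
    rcases j with i | i
    · change p * sigmaInvW p k (sigmaW p k (x (Sum.inl i))) = p * x (Sum.inl i)
      rw [PQPDieudonne.sigmaInvW_sigmaW]
    · change sigmaInvW p k (p * sigmaW p k (x (Sum.inr i))) = p * x (Sum.inr i)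
      rw [map_mul, map_natCast, PQPDieudonne.sigmaInvW_sigmaW]
  form_F := fun x y => by
    simp only [stdForm_apply]
    rw [map_sum]
    refine Finset.sum_congr rfl fun i _ => ?_
    change sigmaW p k (x (Sum.inl i)) * y (Sum.inr i) -
        p * sigmaW p k (x (Sum.inr i)) * y (Sum.inl i) =
      sigmaW p k (x (Sum.inl i) * sigmaInvW p k (y (Sum.inr i)) -
        x (Sum.inr i) * (p * sigmaInvW p k (y (Sum.inl i))))
    rw [map_sub, map_mul, map_mul, map_mul, map_natCast, PQPDieudonne.sigmaW_sigmaInvW, PQPDieudonne.sigmaW_sigmaInvW]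
    ring

end RandomDBT

end

/-!
Let `W = k ^ (2g)`. Up to symplectic automorphisms on both sides, the Frobenius `F₀` is the standard
one, which applies `σ` to the first `g` coordinates and kills the others (`exists_normal_form`: the
kernel and the range of `F₀` are Lagrangian, and `Sp` is transitive on bases of Lagrangians). Hence
`A F₀ B` factors as `β ∘ α` with `β : k ^ g → W` injective, `α : W → k ^ g` surjective and `α ∘ β = σ a`,
where `a` is the upper left `g × g` block of a uniformly distributed symplectic matrix. The stable
rank does not change when the two factors are exchanged (`stableRank_comp_comm`), so the `a`-number is
the nullity of `a` and the `p`-rank is the stable rank of `σ a` (`translate_iff_blockProp`).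

The first `g` columns of a random symplectic matrix are a uniformly distributed isotropic frame.
There are `∏_{i < g} (q ^ (2g - i) - q ^ i)` of them (`card_isFrame`), and the number of frames with
a given upper block `a` depends only on the nullity of `a` (`card_isLowerBlock`). What remains is to
count semilinear endomorphisms of `k ^ g` by nullity `r` and stable rank (`card_semilinear_end`). An
endomorphism with kernel `K` is the same as the endomorphism induced on a complement of `K`, of nullity
`j` say, together with a map from the complement to `K` that is injective on the kernel of the induced
one; the stable ranks agree. This gives a recursion on the dimension, which the closed formula
satisfies by the `q`-Vandermonde identity (`phi_recursion`).

Together, for every `g ≥ s` the probability is exactly the claimed limit with the infinite product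
`∏ (1 + q ^ (-i))⁻¹` truncated at `i = g` (`prob_formula`).
-/

namespace RandomDBT

open Module

/-! ### Counting semilinear maps over a finite field -/

section Semilinear

variable {k : Type*} [Field k] {σ : k →+* k}
variable {V V' : Type*} [AddCommGroup V] [Module k V] [AddCommGroup V'] [Module k V']

/-- A `σ`-semilinear map is freely determined by its values on a basis. -/
noncomputable def semilinearConstr {ι : Type*} [Fintype ι] (b : Basis ι k V) :
    (V →ₛₗ[σ] V') ≃ (ι → V') where
  toFun T i := T (b i)
  invFun v :=
    { toFun := fun x => ∑ i, σ (b.repr x i) • v i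
      map_add' := fun x y => by simp [add_smul, Finset.sum_add_distrib]
      map_smul' := fun c x => by simp [mul_smul, Finset.smul_sum] }
  left_inv T := by
    ext x
    conv_rhs => rw [← b.sum_repr x, map_sum]
    simp
  right_inv v := by
    classical
    ext i
    simp [Finsupp.single_apply, apply_ite σ, ite_smul]

/-- Every subspace is spanned by the first part of some basis of the whole space. -/
theorem exists_basis_adapted [FiniteDimensional k V] (N : Submodule k V) {r m : ℕ}
    (hr : finrank k N = r) (hm : finrank k V = r + m) :
    ∃ b : Basis (Fin r ⊕ Fin m) k V,
      ∀ x, x ∈ N ↔ ∃ c : Fin r → k, x = ∑ i, c i • b (Sum.inl i) := by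
  obtain ⟨C, hC⟩ := N.exists_isCompl
  have hCm : finrank k C = m := by
    have := Submodule.finrank_add_eq_of_isCompl hC
    omega
  let bN := finBasisOfFinrankEq k N hr
  let bC := finBasisOfFinrankEq k C hCm
  refine ⟨(bN.prod bC).map (Submodule.prodEquivOfIsCompl N C hC), fun x => ?_⟩
  simp only [Basis.map_apply, Basis.prod_apply, Sum.elim_inl, LinearMap.coe_inl, Function.comp_apply,
    Submodule.coe_prodEquivOfIsCompl', ZeroMemClass.coe_zero, add_zero]
  constructor
  · intro hx
    refine ⟨bN.repr ⟨x, hx⟩, ?_⟩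
    have h := congrArg N.subtype (bN.sum_repr ⟨x, hx⟩)
    rw [map_sum] at h
    exact h.symm
  · rintro ⟨c, rfl⟩
    exact Submodule.sum_mem _ fun i _ => N.smul_mem _ (bN i).2

/-- A semilinear map is injective on a subspace exactly when it maps a basis of that subspace to an
independent family. -/
theorem linearIndependent_map_iff [RingHomSurjective σ] {r m : ℕ} {N : Submodule k V}
    (b : Basis (Fin r ⊕ Fin m) k V)
    (hb : ∀ x, x ∈ N ↔ ∃ c : Fin r → k, x = ∑ i, c i • b (Sum.inl i)) (T : V →ₛₗ[σ] V') :
    LinearIndependent k (fun i => T (b (Sum.inl i))) ↔ ∀ x ∈ N, T x = 0 → x = 0 := by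
  have hli : LinearIndependent k (fun i => b (Sum.inl i)) :=
    b.linearIndependent.comp _ Sum.inl_injective
  rw [Fintype.linearIndependent_iff] at hli ⊢
  constructor
  · intro h x hx hTx
    obtain ⟨c, rfl⟩ := (hb x).1 hx
    have h0 := h (fun i => σ (c i)) (by simpa [map_sum] using hTx)
    simp [fun i : Fin r => (map_eq_zero σ).1 (h0 i)]
  · intro h c hc i
    choose d hd using fun i => RingHomSurjective.is_surjective (σ := σ) (c i)
    have h0 := h (∑ i, d i • b (Sum.inl i)) ((hb _).2 ⟨d, rfl⟩) (by simpa [map_sum, hd] using hc)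
    rw [← hd i, hli d h0 i, map_zero]

end Semilinear

/-- The product `∏_{i < n} (q ^ m - q ^ i)`, which counts the injective linear maps from
`𝔽_q ^ n` to `𝔽_q ^ m`. -/
noncomputable def injCount (q : ℝ) (n m : ℕ) : ℝ := ∏ i ∈ Finset.range n, (q ^ m - q ^ i)

theorem injCount_eq_zero {q : ℝ} {n m : ℕ} (h : m < n) : injCount q n m = 0 :=
  Finset.prod_eq_zero (Finset.mem_range.2 h) (sub_self _)

theorem injCount_pos {q : ℝ} (hq : 1 < q) {n m : ℕ} (h : n ≤ m) : 0 < injCount q n m :=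
  Finset.prod_pos fun _ hi => sub_pos.2 <|
    pow_lt_pow_right₀ hq ((Finset.mem_range.1 hi).trans_le h)

section Finite

variable {k : Type*} [Field k] [Finite k] {σ : k →+* k}
variable {V V' : Type*} [AddCommGroup V] [Module k V] [AddCommGroup V']
  [Module k V'] [FiniteDimensional k V] [FiniteDimensional k V']

instance finite_semilinear : Finite (V →ₛₗ[σ] V') :=
  have := Module.finite_of_finite k (M := V')
  Finite.of_equiv _ (semilinearConstr (σ := σ) (finBasis k V)).symm

theorem card_linearIndependent_eq (n : ℕ) :
    (Nat.card {v : Fin n → V // LinearIndependent k v} : ℝ) =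
      injCount (Nat.card k) n (finrank k V) := by
  have := Module.finite_of_finite k (M := V)
  have := Fintype.ofFinite k
  by_cases hn : n ≤ finrank k V
  · rw [card_linearIndependent hn, injCount, Finset.prod_range, Nat.cast_prod]
    refine Finset.prod_congr rfl fun i _ => ?_
    rw [Nat.cast_sub (Nat.pow_le_pow_right Fintype.card_pos (i.2.le.trans hn)),
      Nat.card_eq_fintype_card]
    simp
  · rw [injCount_eq_zero (not_le.1 hn), Nat.cast_eq_zero]
    have : IsEmpty {v : Fin n → V // LinearIndependent k v} :=
      ⟨fun v => hn (by simpa using v.2.fintype_card_le_finrank)⟩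
    exact Nat.card_of_isEmpty

theorem one_lt_card_real : (1 : ℝ) < Nat.card k := by
  exact_mod_cast Finite.one_lt_card (α := k)

/-- The number of semilinear maps `V → V'` that are injective on a given subspace. -/
theorem card_injOn [RingHomSurjective σ] (N : Submodule k V) {r m : ℕ}
    (hr : finrank k N = r) (hm : finrank k V = r + m) :
    (Nat.card {T : V →ₛₗ[σ] V' // ∀ x ∈ N, T x = 0 → x = 0} : ℝ) =
      injCount (Nat.card k) r (finrank k V') * (Nat.card k : ℝ) ^ (finrank k V' * m) := by
  have := Module.finite_of_finite k (M := V')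
  obtain ⟨b, hb⟩ := exists_basis_adapted N hr hm
  let e : {T : V →ₛₗ[σ] V' // ∀ x ∈ N, T x = 0 → x = 0} ≃
      {v : Fin r → V' // LinearIndependent k v} × (Fin m → V') :=
    calc {T : V →ₛₗ[σ] V' // ∀ x ∈ N, T x = 0 → x = 0}
      _ ≃ {w : Fin r ⊕ Fin m → V' // LinearIndependent k fun i => w (Sum.inl i)} :=
          (semilinearConstr b).subtypeEquiv fun T => (linearIndependent_map_iff b hb T).symm
      _ ≃ {w : (Fin r → V') × (Fin m → V') // LinearIndependent k w.1} :=
          (Equiv.sumArrowEquivProdArrow (Fin r) (Fin m) V').subtypeEquiv fun _ => Iff.rfl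
      _ ≃ {v : Fin r → V' // LinearIndependent k v} × (Fin m → V') :=
          Equiv.prodSubtypeFstEquivSubtypeProd (α := Fin r → V') (β := Fin m → V')
            (p := fun v => LinearIndependent k v)
  rw [Nat.card_congr e, Nat.card_prod, Nat.cast_mul, card_linearIndependent_eq, Nat.card_fun,
    Module.natCard_eq_pow_finrank (K := k) (V := V')]
  simp [pow_mul]

/-- The number of `r`-dimensional subspaces. -/
theorem card_subspaces (r : ℕ) :
    (Nat.card {K : Submodule k V // finrank k K = r} : ℝ) * injCount (Nat.card k) r r =
      injCount (Nat.card k) r (finrank k V) := by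
  have := Module.finite_of_finite k (M := V)
  rw [← card_linearIndependent_eq]
  have hs : ∀ (K : Submodule k V) (_ : finrank k K = r) (v : Fin r → K), LinearIndependent k v →
      Submodule.span k (Set.range fun i => (v i : V)) = K := by
    intro K hK v hv
    have h := congrArg (Submodule.map K.subtype)
      (hv.span_eq_top_of_card_eq_finrank' (by simpa using hK.symm))
    rw [Submodule.map_span, Submodule.map_subtype_top, ← Set.range_comp] at h
    exact h
  have e : (Σ K : {K : Submodule k V // finrank k K = r},
      {v : Fin r → K.1 // LinearIndependent k v}) ≃ {v : Fin r → V // LinearIndependent k v} := by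
    refine Equiv.ofBijective
      (fun p => ⟨fun i => p.2.1 i, p.2.2.map' p.1.1.subtype p.1.1.ker_subtype⟩) ⟨?_, ?_⟩
    · rintro ⟨⟨K, hK⟩, ⟨v, hv⟩⟩ ⟨⟨K', hK'⟩, ⟨v', hv'⟩⟩ h
      have h' : (fun i => (v i : V)) = fun i => (v' i : V) := congrArg Subtype.val h
      obtain rfl : K = K' := by rw [← hs K hK v hv, h', hs K' hK' v' hv']
      obtain rfl : v = v' := funext fun i => Subtype.ext (congrFun h' i)
      rfl
    · intro v
      exact ⟨⟨⟨Submodule.span k (Set.range v.1), by simpa using finrank_span_eq_card v.2⟩,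
        ⟨fun i => ⟨v.1 i, Submodule.subset_span ⟨i, rfl⟩⟩, linearIndependent_span v.2⟩⟩, rfl⟩
  have := Fintype.ofFinite {K : Submodule k V // finrank k K = r}
  rw [← Nat.card_congr e, Nat.card_sigma, Nat.cast_sum, Finset.sum_congr rfl fun K _ => by
    rw [card_linearIndependent_eq, K.2]]
  simp

end Finite

/-! ### The stable rank of a semilinear endomorphism -/

section StableRank

variable {k : Type*} [Field k] {σ : k →+* k} [RingHomSurjective σ]
variable {V V' : Type*} [AddCommGroup V] [Module k V] [AddCommGroup V'] [Module k V']

/-- The largest subspace on which a semilinear endomorphism is bijective. -/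
def stablePart (T : V →ₛₗ[σ] V) : Submodule k V :=
  sSup {U : Submodule k V | Set.BijOn T U U}

/-- The dimension of the largest subspace on which a semilinear endomorphism is bijective. -/
noncomputable def stableRank (T : V →ₛₗ[σ] V) : ℕ := finrank k (stablePart T)

theorem map_stablePart (T : V →ₛₗ[σ] V) : (stablePart T).map T = stablePart T := by
  have h : ∀ U ∈ {U : Submodule k V | Set.BijOn T U U}, U.map T = U := fun U hU =>
    SetLike.coe_injective hU.image_eq
  rw [stablePart, sSup_eq_iSup, Submodule.map_iSup]
  refine iSup_congr fun U => ?_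
  rw [Submodule.map_iSup]
  exact iSup_congr fun hU => h U hU

variable [Finite V]

theorem injOn_of_map_eq {T : V →ₛₗ[σ] V} {U : Submodule k V} (h : U.map T = U) :
    Set.InjOn T U := by
  have h' : T '' U = U := congrArg SetLike.coe h
  exact Set.injOn_of_ncard_image_eq (by rw [h']) (Set.toFinite _)

theorem le_stablePart {T : V →ₛₗ[σ] V} {U : Submodule k V} (h : U.map T = U) :
    U ≤ stablePart T := by
  refine le_sSup ⟨fun x hx => ?_, injOn_of_map_eq h, fun x hx => ?_⟩
  · exact h ▸ Submodule.mem_map_of_mem hx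
  · rw [← h] at hx
    exact hx

theorem injOn_stablePart (T : V →ₛₗ[σ] V) : Set.InjOn T (stablePart T) :=
  injOn_of_map_eq (map_stablePart T)

theorem ker_inf_stablePart (T : V →ₛₗ[σ] V) : LinearMap.ker T ⊓ stablePart T = ⊥ := by
  rw [eq_bot_iff]
  rintro x ⟨hx, hxs⟩
  exact injOn_stablePart T hxs (zero_mem _) (by rw [LinearMap.mem_ker.1 hx, map_zero])

variable [Finite k]

theorem finrank_le_of_ncard_le {U : Submodule k V} {U' : Submodule k V'} [Finite V']
    (h : (U : Set V).ncard ≤ (U' : Set V').ncard) : finrank k U ≤ finrank k U' := by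
  have h1 : Nat.card U = Nat.card k ^ finrank k U := Module.natCard_eq_pow_finrank
  have h2 : Nat.card U' = Nat.card k ^ finrank k U' := Module.natCard_eq_pow_finrank
  change Nat.card U ≤ Nat.card U' at h
  rw [h1, h2] at h
  exact (Nat.pow_le_pow_iff_right Finite.one_lt_card).1 h

theorem finrank_ker_add_stableRank_le (T : V →ₛₗ[σ] V) :
    finrank k (LinearMap.ker T) + stableRank T ≤ finrank k V := by
  have h := Submodule.finrank_sup_add_finrank_inf_eq (LinearMap.ker T) (stablePart T)
  rw [ker_inf_stablePart, finrank_bot, add_zero] at h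
  rw [stableRank, ← h]
  exact Submodule.finrank_le _

theorem stableRank_le (T : V →ₛₗ[σ] V) : stableRank T ≤ finrank k V :=
  (Nat.le_add_left _ _).trans (finrank_ker_add_stableRank_le T)

theorem stableRank_of_ker_eq_bot {T : V →ₛₗ[σ] V} (h : LinearMap.ker T = ⊥) :
    stableRank T = finrank k V := by
  have h1 : (⊤ : Submodule k V).map T = ⊤ := by
    rw [Submodule.map_top, LinearMap.range_eq_top]
    exact Finite.surjective_of_injective (LinearMap.ker_eq_bot.1 h)
  rw [stableRank, top_le_iff.1 (le_stablePart h1), finrank_top]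

variable [Finite V']

/-- `α` embeds the stable part of `β ∘ α` into the stable part of `α ∘ β`, and `β` does the
converse. -/
theorem stableRank_comp_comm (α : V →ₛₗ[σ] V') (β : V' →ₗ[k] V) :
    stableRank (β.comp α : V →ₛₗ[σ] V) = stableRank (α.comp β : V' →ₛₗ[σ] V') := by
  have h1 := map_stablePart (β.comp α : V →ₛₗ[σ] V)
  have h2 := map_stablePart (α.comp β : V' →ₛₗ[σ] V')
  rw [Submodule.map_comp] at h1 h2
  apply le_antisymm
  · have h3 := le_stablePart (T := (α.comp β : V' →ₛₗ[σ] V'))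
      (U := (stablePart (β.comp α : V →ₛₗ[σ] V)).map α) (by rw [Submodule.map_comp, h1])
    apply finrank_le_of_ncard_le
    rw [← Set.InjOn.ncard_image (f := α) fun x hx y hy hxy =>
      injOn_stablePart (β.comp α : V →ₛₗ[σ] V) hx hy (congrArg β hxy)]
    exact Set.ncard_le_ncard h3 (Set.toFinite _)
  · have h3 := le_stablePart (T := (β.comp α : V →ₛₗ[σ] V))
      (U := (stablePart (α.comp β : V' →ₛₗ[σ] V')).map β) (by rw [Submodule.map_comp, h2])
    apply finrank_le_of_ncard_le
    rw [← Set.InjOn.ncard_image (f := β) fun x hx y hy hxy =>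
      injOn_stablePart (α.comp β : V' →ₛₗ[σ] V') hx hy (congrArg α hxy)]
    exact Set.ncard_le_ncard h3 (Set.toFinite _)

end StableRank

/-! ### Gaussian binomial coefficients -/

/-- The finite `q`-Pochhammer product `(1 - x) (1 - x ^ 2) ⋯ (1 - x ^ n)`. -/
def poch (x : ℝ) (n : ℕ) : ℝ := ∏ i ∈ Finset.range n, (1 - x ^ (i + 1))

/-- The Gaussian binomial coefficient with parameter `x`, defined by one of the two `q`-Pascal
recursions. -/
def gaussBinom (x : ℝ) : ℕ → ℕ → ℝ
  | _, 0 => 1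
  | 0, _ + 1 => 0
  | n + 1, j + 1 => gaussBinom x n (j + 1) + x ^ (n - j) * gaussBinom x n j

theorem gaussBinom_zero_right (x : ℝ) (n : ℕ) : gaussBinom x n 0 = 1 := by
  cases n <;> rfl

theorem gaussBinom_succ_succ (x : ℝ) (n j : ℕ) : gaussBinom x (n + 1) (j + 1) =
    gaussBinom x n (j + 1) + x ^ (n - j) * gaussBinom x n j := rfl

theorem gaussBinom_eq_zero (x : ℝ) {n j : ℕ} (h : n < j) : gaussBinom x n j = 0 := by
  induction n generalizing j with
  | zero => obtain ⟨j, rfl⟩ := Nat.exists_eq_succ_of_ne_zero h.ne'; rfl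
  | succ n ih =>
    obtain ⟨j, rfl⟩ := Nat.exists_eq_succ_of_ne_zero (Nat.ne_zero_of_lt h)
    rw [gaussBinom_succ_succ, ih (by omega), ih (by omega), mul_zero, add_zero]

theorem poch_succ (x : ℝ) (n : ℕ) : poch x (n + 1) = poch x n * (1 - x ^ (n + 1)) :=
  Finset.prod_range_succ _ _

theorem gaussBinom_mul_poch (x : ℝ) (j d : ℕ) :
    gaussBinom x (j + d) j * (poch x j * poch x d) = poch x (j + d) := by
  induction j generalizing d with
  | zero => simp [gaussBinom_zero_right, poch]
  | succ j ihj =>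
    induction d with
    | zero =>
      have h := ihj 0
      simp only [add_zero] at h ⊢
      rw [gaussBinom_succ_succ, gaussBinom_eq_zero x (Nat.lt_succ_self j), Nat.sub_self, pow_zero,
        poch_succ]
      linear_combination (1 - x ^ (j + 1)) * h
    | succ d ihd =>
      have h := ihj (d + 1)
      rw [show j + 1 + d = j + (d + 1) by ring] at ihd
      rw [show j + 1 + (d + 1) = j + (d + 1) + 1 by ring, gaussBinom_succ_succ,
        show j + (d + 1) - j = d + 1 by omega, poch_succ x (j + (d + 1))]
      have h1 : gaussBinom x (j + (d + 1)) (j + 1) * (poch x (j + 1) * poch x (d + 1)) =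
          poch x (j + (d + 1)) * (1 - x ^ (d + 1)) := by
        rw [← ihd, poch_succ x d]; ring
      have h2 : gaussBinom x (j + (d + 1)) j * (poch x (j + 1) * poch x (d + 1)) =
          poch x (j + (d + 1)) * (1 - x ^ (j + 1)) := by
        rw [← h, poch_succ x j]; ring
      rw [add_mul, h1, mul_assoc, h2]
      ring

/-- The `q`-Vandermonde convolution. -/
theorem gaussBinom_add (x : ℝ) (m n K : ℕ) : gaussBinom x (m + n) K =
    ∑ ij ∈ Finset.HasAntidiagonal.antidiagonal K,
      x ^ ((m - ij.1) * ij.2) * gaussBinom x m ij.1 * gaussBinom x n ij.2 := by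
  induction n generalizing K with
  | zero =>
    rw [Finset.sum_eq_single (K, 0)]
    · simp [gaussBinom_zero_right]
    · rintro ⟨i, j⟩ hij hne
      rw [Finset.HasAntidiagonal.mem_antidiagonal] at hij
      have hj : 0 < j := by
        rcases Nat.eq_zero_or_pos j with rfl | h
        · exact absurd (by simpa using hij) (by simpa using hne)
        · exact h
      simp [gaussBinom_eq_zero x hj]
    · simp
  | succ n ih =>
    cases K with
    | zero => simp [gaussBinom_zero_right]
    | succ K =>
      rw [← add_assoc, gaussBinom_succ_succ, ih, ih, Finset.Nat.sum_antidiagonal_succ',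
        Finset.Nat.sum_antidiagonal_succ', add_assoc, gaussBinom_zero_right,
        gaussBinom_zero_right, Finset.mul_sum, ← Finset.sum_add_distrib]
      congr 1
      refine Finset.sum_congr rfl fun ij hij => ?_
      obtain ⟨i, j⟩ := ij
      rw [Finset.HasAntidiagonal.mem_antidiagonal] at hij
      simp only at hij ⊢
      rw [gaussBinom_succ_succ]
      rcases lt_or_ge m i with hm | hm
      · simp [gaussBinom_eq_zero x hm]
      rcases lt_or_ge n j with hn | hn
      · simp [gaussBinom_eq_zero x hn]
      have he : x ^ ((m - i) * (j + 1)) * x ^ (n - j) = x ^ (m + n - K) * x ^ ((m - i) * j) := by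
        rw [← pow_add, ← pow_add]
        congr 1
        rw [mul_add, mul_one]
        omega
      linear_combination -(gaussBinom x m i * gaussBinom x n j) * he

/-! ### The law of the corank given the nullity -/

/-- With `x = 1 / q`, the number `phi x r s` is, up to a factor that depends only on `n` and `r`, the
proportion of semilinear endomorphisms of `𝔽_q ^ n` with nullity `r` and stable rank `n - s`, for
`r ≤ s ≤ n`. -/
noncomputable def phi (x : ℝ) (r s : ℕ) : ℝ :=
  x ^ (s - r) * (∏ i ∈ Finset.Ico r s, (1 - x ^ i)) * ∏ i ∈ Finset.Icc 1 (s - r), (1 - x ^ i)⁻¹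

theorem phi_self (x : ℝ) (r : ℕ) : phi x r r = 1 := by simp [phi]

theorem phi_zero_left (x : ℝ) {s : ℕ} (hs : 0 < s) : phi x 0 s = 0 := by
  rw [phi, Finset.prod_eq_zero (i := 0) (by simpa using hs) (by simp)]
  simp

variable {x : ℝ}

theorem poch_pos (h0 : 0 < x) (h1 : x < 1) (n : ℕ) : 0 < poch x n :=
  Finset.prod_pos fun i _ => sub_pos.2 (pow_lt_one₀ h0.le h1 (Nat.succ_ne_zero i))

theorem phi_succ_left (h0 : 0 < x) (h1 : x < 1) (r d : ℕ) :
    phi x (r + 1) (r + 1 + d) = x ^ d * gaussBinom x (d + r) d := by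
  have hd := (poch_pos h0 h1 d).ne'
  have hr := (poch_pos h0 h1 r).ne'
  have e1 : ∏ i ∈ Finset.Icc 1 d, (1 - x ^ i)⁻¹ = (poch x d)⁻¹ := by
    rw [Finset.prod_inv_distrib, poch, ← Finset.Ico_add_one_right_eq_Icc,
      Finset.prod_Ico_eq_prod_range]
    simp only [Nat.add_sub_cancel, add_comm 1]
  have e2 : (∏ i ∈ Finset.Ico (r + 1) (r + 1 + d), (1 - x ^ i)) * poch x r = poch x (d + r) := by
    rw [poch, poch, add_comm d r, Finset.prod_range_add, Finset.prod_Ico_eq_prod_range, mul_comm,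
      Nat.add_sub_cancel_left]
    simp only [add_right_comm]
  have e3 := gaussBinom_mul_poch x d r
  rw [phi, Nat.add_sub_cancel_left, e1]
  field_simp
  apply mul_right_cancel₀ hr
  rw [e2, ← e3]
  ring

theorem injCount_mul_poch {q : ℝ} (hq : q ≠ 0) (j e : ℕ) :
    injCount q j (j + e) * poch q⁻¹ e = q ^ ((j + e) * j) * poch q⁻¹ (j + e) := by
  induction j with
  | zero => simp [injCount]
  | succ j ih =>
    have h : injCount q (j + 1) (j + 1 + e) = (q ^ (j + 1 + e) - 1) * q ^ j * injCount q j (j + e) := by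
      have hp : q ^ j = ∏ _i ∈ Finset.range j, q := by simp
      rw [injCount, injCount, Finset.prod_range_succ', pow_zero, mul_comm, mul_assoc, hp,
        ← Finset.prod_mul_distrib]
      congr 1
      exact Finset.prod_congr rfl fun i _ => by ring
    rw [h, mul_assoc, ih, show j + 1 + e = j + e + 1 by ring, poch_succ, inv_pow]
    have : q ^ (j + e + 1) ≠ 0 := pow_ne_zero _ hq
    field_simp
    ring

theorem injCount_eq {q : ℝ} (hq : 1 < q) (j R : ℕ) :
    injCount q j R = q ^ (R * j) * q⁻¹ ^ (j * j) * gaussBinom q⁻¹ R j * injCount q j j := by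
  have hq0 : q ≠ 0 := by positivity
  have h0 : 0 < q⁻¹ := by positivity
  have h1 : q⁻¹ < 1 := inv_lt_one_of_one_lt₀ hq
  rcases lt_or_ge R j with h | h
  · rw [injCount_eq_zero h, gaussBinom_eq_zero _ h]; ring
  obtain ⟨e, rfl⟩ := Nat.exists_eq_add_of_le h
  have e1 := injCount_mul_poch hq0 j e
  have e2 := injCount_mul_poch hq0 j 0
  rw [← gaussBinom_mul_poch] at e1
  simp only [add_zero, poch, Finset.range_zero, Finset.prod_empty, mul_one] at e2
  apply mul_right_cancel₀ (poch_pos h0 h1 e).ne'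
  rw [e1, e2, inv_pow, poch]
  field_simp

/-- The recursion for `phi`: an endomorphism with kernel of dimension `r` induces an
endomorphism of the quotient by its kernel, whose kernel has some dimension `j`. -/
theorem phi_recursion {q : ℝ} (hq : 1 < q) {r : ℕ} (hr : 0 < r) (d : ℕ) :
    phi q⁻¹ r (r + d) = ∑ j ∈ Finset.range (d + 1),
      phi q⁻¹ j d * (q⁻¹ ^ (r * j) * injCount q j r / injCount q j j) := by
  have h0 : 0 < q⁻¹ := by positivity
  have h1 : q⁻¹ < 1 := inv_lt_one_of_one_lt₀ hq
  obtain ⟨a, rfl⟩ := Nat.exists_eq_succ_of_ne_zero hr.ne'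
  have hterm : ∀ j, q⁻¹ ^ ((a + 1) * j) * injCount q j (a + 1) / injCount q j j =
      q⁻¹ ^ (j * j) * gaussBinom q⁻¹ (a + 1) j := by
    intro j
    have hp := (injCount_pos hq (le_refl j)).ne'
    rw [injCount_eq hq j (a + 1), inv_pow]
    field_simp
  simp only [Nat.succ_eq_add_one, hterm]
  cases d with
  | zero => simp [phi_self, gaussBinom_zero_right]
  | succ d =>
    rw [phi_succ_left h0 h1, Finset.sum_range_succ', phi_zero_left _ d.succ_pos, zero_mul, add_zero,
      show d + 1 + a = d + (a + 1) by ring, gaussBinom_add, Finset.Nat.sum_antidiagonal_succ',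
      gaussBinom_eq_zero _ (Nat.lt_succ_self d), mul_zero, zero_mul, zero_add,
      Finset.Nat.sum_antidiagonal_eq_sum_range_succ_mk, ← Finset.sum_range_reflect, Finset.mul_sum]
    refine Finset.sum_congr rfl fun j hj => ?_
    obtain ⟨e, rfl⟩ := Nat.exists_eq_add_of_le (Nat.lt_succ_iff.1 (Finset.mem_range.1 hj))
    simp only [Nat.succ_eq_add_one]
    rw [show j + e + 1 = j + 1 + e by ring, phi_succ_left h0 h1,
      show j + e - (j + 1 + e - 1 - j) = j by omega, show j + 1 + e - 1 - j = e by omega, add_comm e j]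
    ring

/-! ### Counting semilinear endomorphisms by nullity and stable rank -/

theorem card_sigma_of_const {ι : Type*} [Finite ι] {β : ι → Type*} [∀ i, Finite (β i)] {c : ℝ}
    (h : ∀ i, (Nat.card (β i) : ℝ) = c) : (Nat.card (Σ i, β i) : ℝ) = Nat.card ι * c := by
  have := Fintype.ofFinite ι
  rw [Nat.card_sigma, Nat.cast_sum, Finset.sum_congr rfl fun i _ => h i]
  simp

theorem injCount_add_self (q : ℝ) (r m : ℕ) :
    injCount q (r + m) (r + m) = injCount q r (r + m) * (q ^ (r * m) * injCount q m m) := by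
  have hp : q ^ (r * m) = ∏ _i ∈ Finset.range m, q ^ r := by simp [pow_mul]
  rw [injCount, Finset.prod_range_add, injCount, hp, injCount, ← Finset.prod_mul_distrib]
  congr 1
  exact Finset.prod_congr rfl fun i _ => by ring

section Split

variable {k : Type*} [Field k] [Finite k] {σ : k →+* k} [RingHomSurjective σ]
variable {V : Type*} [AddCommGroup V] [Module k V] [FiniteDimensional k V]

theorem exists_projections {K C : Submodule k V} (h : IsCompl K C) :
    ∃ (pK : V →ₗ[k] K) (pC : V →ₗ[k] C), (∀ x, (pK x : V) + pC x = x) ∧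
      (∀ x : K, pK x = x ∧ pC x = 0) ∧ (∀ x : C, pK x = 0 ∧ pC x = x) := by
  refine ⟨LinearMap.fst k K C ∘ₗ (Submodule.prodEquivOfIsCompl K C h).symm.toLinearMap,
    LinearMap.snd k K C ∘ₗ (Submodule.prodEquivOfIsCompl K C h).symm.toLinearMap,
    fun x => ?_, fun x => ?_, fun x => ?_⟩
  · obtain ⟨y, rfl⟩ := (Submodule.prodEquivOfIsCompl K C h).surjective x
    simp
  · simp
  · simp

/-- A semilinear endomorphism with kernel `K` amounts to the endomorphism that it induces on
`V / K`, here identified with a complement `C` of `K`, together with the component `C → K`, which has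
to be injective on the kernel of the induced endomorphism. The stable ranks agree. -/
theorem exists_equiv_ker_eq {K C : Submodule k V} (h : IsCompl K C) (ρ : ℕ → Prop) :
    Nonempty ((Σ T' : {T' : C →ₛₗ[σ] C // ρ (stableRank T')},
        {B : C →ₛₗ[σ] K // ∀ x ∈ LinearMap.ker T'.1, B x = 0 → x = 0}) ≃
      {T : V →ₛₗ[σ] V // LinearMap.ker T = K ∧ ρ (stableRank T)}) := by
  have : Finite V := Module.finite_of_finite k
  obtain ⟨pK, pC, hp, hK, hC⟩ := exists_projections h
  let G (T' : C →ₛₗ[σ] C) (B : C →ₛₗ[σ] K) : C →ₛₗ[σ] V :=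
    C.subtype.comp T' + K.subtype.comp B
  have hGK : ∀ T' B x, pK (G T' B x) = B x := fun T' B x => by
    simp [G, (hK _).1, (hC _).1]
  have hGC : ∀ T' B x, pC (G T' B x) = T' x := fun T' B x => by
    simp [G, (hK _).2, (hC _).2]
  have hsr : ∀ T' B, stableRank ((G T' B).comp pC : V →ₛₗ[σ] V) = stableRank T' := fun T' B => by
    rw [← stableRank_comp_comm (G T' B) pC]
    congr 1
    ext x
    exact congrArg Subtype.val (hGC T' B x)
  have hker : ∀ T' B, LinearMap.ker ((G T' B).comp pC : V →ₛₗ[σ] V) = K ↔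
      ∀ x ∈ LinearMap.ker T', B x = 0 → x = 0 := by
    intro T' B
    constructor
    · intro hk x hx hB
      have h0 : (x : V) ∈ K := by
        rw [← hk, LinearMap.mem_ker, LinearMap.comp_apply, (hC x).2, ← hp (G T' B x), hGK, hGC, hB,
          LinearMap.mem_ker.1 hx]
        simp
      exact Subtype.ext (Submodule.disjoint_def.1 h.disjoint x h0 x.2)
    · intro hB
      ext x
      rw [LinearMap.mem_ker, LinearMap.comp_apply]
      constructor
      · intro hx
        have h1 : pC x = 0 := hB _
          (by rw [LinearMap.mem_ker, ← hGC T' B, hx, map_zero]) (by rw [← hGK T' B, hx, map_zero])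
        rw [← hp x, h1]
        simp
      · intro hx
        rw [(hK ⟨x, hx⟩).2, map_zero]
  refine ⟨Equiv.ofBijective (fun p => ⟨(G p.1.1 p.2.1).comp pC, (hker _ _).2 p.2.2,
    (hsr p.1.1 p.2.1).symm ▸ p.1.2⟩) ⟨?_, ?_⟩⟩
  · rintro ⟨⟨T, hT⟩, ⟨B, hB⟩⟩ ⟨⟨T', hT'⟩, ⟨B', hB'⟩⟩ he
    have he' : ∀ x : C, G T B x = G T' B' x := fun x => by
      have := LinearMap.congr_fun (congrArg Subtype.val he) (x : V)
      simpa [(hC x).2] using this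
    obtain rfl : T = T' := LinearMap.ext fun x => by rw [← hGC T B, he', hGC]
    obtain rfl : B = B' := LinearMap.ext fun x => by rw [← hGK T B, he', hGK]
    rfl
  · rintro ⟨T, hT, hρ⟩
    let T₁ : C →ₛₗ[σ] V := T.comp C.subtype
    have hT₁ : (G (pC.comp T₁) (pK.comp T₁)).comp pC = T := by
      ext x
      have h1 : T x = T (pC x) := by
        have h2 : T (pK x) = 0 := by
          rw [← LinearMap.mem_ker, hT]; exact (pK x).2
        conv_lhs => rw [← hp x, map_add, h2, zero_add]
      rw [h1, ← hp (T (pC x)), add_comm]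
      rfl
    refine ⟨⟨⟨pC.comp T₁, ?_⟩, ⟨pK.comp T₁, ?_⟩⟩, Subtype.ext hT₁⟩
    · rw [← hsr _ (pK.comp T₁), hT₁]; exact hρ
    · rw [← hker, hT₁]; exact hT

end Split

variable {k : Type*} [Field k] [Finite k] {σ : k →+* k} [RingHomSurjective σ]

/-- The endomorphisms of `V` with kernel `K`, sorted by the nullity `j` of the induced endomorphism `T'`
of a complement `C`; the last factor is the number of semilinear maps `C → K` that are injective on the
kernel of `T'`. -/
theorem card_ker_eq {V : Type*} [AddCommGroup V] [Module k V] [FiniteDimensional k V]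
    {K C : Submodule k V} (h : IsCompl K C) {r m d : ℕ} (hr : finrank k K = r)
    (hm : finrank k C = m) :
    (Nat.card {T : V →ₛₗ[σ] V // LinearMap.ker T = K ∧ r + m - stableRank T = r + d} : ℝ) =
      ∑ j ∈ Finset.range (d + 1),
        Nat.card {T' : C →ₛₗ[σ] C // finrank k (LinearMap.ker T') = j ∧ m - stableRank T' = d} *
          (injCount (Nat.card k) j r * (Nat.card k : ℝ) ^ (r * (m - j))) := by
  classical
  have : Finite V := Module.finite_of_finite k
  -- A kernel of dimension `r` forces `stableRank T ≤ m`, so the truncated subtractions agree.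
  have e1 : {T : V →ₛₗ[σ] V // LinearMap.ker T = K ∧ r + m - stableRank T = r + d} ≃
      {T : V →ₛₗ[σ] V // LinearMap.ker T = K ∧
        (stableRank T ≤ m ∧ m - stableRank T = d)} := by
    refine Equiv.subtypeEquivRight fun T => and_congr_right fun hT => ?_
    have h1 := finrank_ker_add_stableRank_le T
    have h2 := Submodule.finrank_add_eq_of_isCompl h
    rw [hT] at h1
    omega
  obtain ⟨e2⟩ := exists_equiv_ker_eq (σ := σ) h fun n => n ≤ m ∧ m - n = d
  have := Fintype.ofFinite (C →ₛₗ[σ] C)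
  have hcard : ∀ T' : C →ₛₗ[σ] C,
      (Nat.card {B : C →ₛₗ[σ] K // ∀ x ∈ LinearMap.ker T', B x = 0 → x = 0} : ℝ) =
        injCount (Nat.card k) (finrank k (LinearMap.ker T')) r *
          (Nat.card k : ℝ) ^ (r * (m - finrank k (LinearMap.ker T'))) := fun T' => by
    have hle := Submodule.finrank_le (LinearMap.ker T')
    rw [card_injOn (LinearMap.ker T') rfl (m := m - finrank k (LinearMap.ker T')) (by omega), hr]
  rw [Nat.card_congr (e1.trans e2.symm), Nat.card_sigma, Nat.cast_sum,
    Finset.sum_congr rfl fun T' _ => hcard T'.1,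
    ← Finset.sum_fiberwise_of_maps_to
      (g := fun T' : {T' : C →ₛₗ[σ] C // stableRank T' ≤ m ∧ m - stableRank T' = d} =>
        finrank k (LinearMap.ker T'.1)) (t := Finset.range (d + 1))]
  · refine Finset.sum_congr rfl fun j _ => ?_
    rw [Finset.sum_congr rfl (g := fun _ => injCount (Nat.card k) j r *
      (Nat.card k : ℝ) ^ (r * (m - j))) fun T' hT' => by rw [(Finset.mem_filter.1 hT').2]]
    rw [Finset.sum_const, nsmul_eq_mul]
    congr 2
    rw [← Fintype.card_subtype, ← Nat.card_eq_fintype_card]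
    refine Nat.card_congr ((Equiv.subtypeSubtypeEquivSubtypeInter
      (fun T' : C →ₛₗ[σ] C => stableRank T' ≤ m ∧ m - stableRank T' = d)
      (fun T' => finrank k (LinearMap.ker T') = j)).trans
      (Equiv.subtypeEquivRight fun T' => ?_))
    have h1 := stableRank_le T'
    rw [hm] at h1
    tauto
  · intro T' _
    have h1 := finrank_ker_add_stableRank_le T'.1
    have h2 := T'.2
    rw [Finset.mem_range]
    omega

/-- The number of semilinear endomorphisms with given nullity and stable rank, by induction on the
dimension: fix the kernel and pass to a complement. -/
theorem card_semilinear_end (n : ℕ) : ∀ (V : Type*) [AddCommGroup V] [Module k V]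
    [FiniteDimensional k V], finrank k V = n → ∀ r s : ℕ, r ≤ s → s ≤ n →
    (Nat.card {T : V →ₛₗ[σ] V // finrank k (LinearMap.ker T) = r ∧ n - stableRank T = s} : ℝ) =
      injCount (Nat.card k) n n * phi (Nat.card k : ℝ)⁻¹ r s / injCount (Nat.card k) r r := by
  induction n using Nat.strong_induction_on with
  | _ n ih =>
  intro V _ _ _ hn r s hrs hsn
  have : Finite V := Module.finite_of_finite k
  have hq := one_lt_card_real (k := k)
  rcases Nat.eq_zero_or_pos r with rfl | hr
  · -- injective endomorphisms have full stable rank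
    have hsr : ∀ T : V →ₛₗ[σ] V, finrank k (LinearMap.ker T) = 0 → stableRank T = n := fun T hT => by
      rw [stableRank_of_ker_eq_bot (Submodule.finrank_eq_zero.1 hT), hn]
    rcases Nat.eq_zero_or_pos s with rfl | hs
    · rw [phi_self]
      have h := card_injOn (σ := σ) (V' := V) (⊤ : Submodule k V) (finrank_top k V) (m := 0) rfl
      rw [hn, mul_zero, pow_zero, mul_one] at h
      simp only [injCount, Finset.range_zero, Finset.prod_empty, mul_one, div_one]
      rw [← injCount, ← h]
      congr 1
      refine Nat.card_congr (Equiv.subtypeEquivRight fun T => ?_)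
      rw [Submodule.finrank_eq_zero, LinearMap.ker_eq_bot']
      constructor
      · exact fun hT x _ => hT.1 x
      · intro hT
        refine ⟨fun x => hT x trivial, ?_⟩
        rw [hsr T (Submodule.finrank_eq_zero.2 (LinearMap.ker_eq_bot'.2 fun x => hT x trivial)),
          Nat.sub_self]
    · rw [phi_zero_left _ hs, mul_zero, zero_div, Nat.cast_eq_zero]
      have : IsEmpty {T : V →ₛₗ[σ] V //
          finrank k (LinearMap.ker T) = 0 ∧ n - stableRank T = s} := ⟨fun T => by
        have := hsr T.1 T.2.1
        have := T.2.2
        omega⟩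
      exact Nat.card_of_isEmpty
  obtain ⟨d, rfl⟩ := Nat.exists_eq_add_of_le hrs
  obtain ⟨m, rfl⟩ := Nat.exists_eq_add_of_le (hrs.trans hsn)
  have e : {T : V →ₛₗ[σ] V // finrank k (LinearMap.ker T) = r ∧ r + m - stableRank T = r + d} ≃
      Σ K : {K : Submodule k V // finrank k K = r},
        {T : V →ₛₗ[σ] V // LinearMap.ker T = K.1 ∧ r + m - stableRank T = r + d} :=
    { toFun := fun T => ⟨⟨LinearMap.ker T.1, T.2.1⟩, ⟨T.1, rfl, T.2.2⟩⟩
      invFun := fun p => ⟨p.2.1, by rw [p.2.2.1]; exact p.1.2, p.2.2.2⟩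
      left_inv := fun T => rfl
      right_inv := by
        rintro ⟨⟨K, hK⟩, ⟨T, hTK, hT⟩⟩
        change LinearMap.ker T = K at hTK
        subst hTK
        rfl }
  have hpos : ∀ j : ℕ, injCount (Nat.card k) j j ≠ 0 := fun j => (injCount_pos hq le_rfl).ne'
  have hK := card_subspaces (k := k) (V := V) r
  rw [hn] at hK
  rw [Nat.card_congr e, card_sigma_of_const (c := injCount (Nat.card k) m m *
    (Nat.card k : ℝ) ^ (r * m) * phi (Nat.card k : ℝ)⁻¹ r (r + d))]
  · rw [injCount_add_self, ← hK]
    field_simp [hpos r]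
  · rintro ⟨K, hK⟩
    obtain ⟨C, hC⟩ := K.exists_isCompl
    have hm : finrank k C = m := by
      have := Submodule.finrank_add_eq_of_isCompl hC
      omega
    rw [card_ker_eq hC hK hm, phi_recursion hq hr, Finset.mul_sum]
    refine Finset.sum_congr rfl fun j hj => ?_
    have hjd : j ≤ d := Nat.lt_succ_iff.1 (Finset.mem_range.1 hj)
    obtain ⟨i, rfl⟩ := Nat.exists_eq_add_of_le (show j ≤ m by omega)
    rw [ih _ (by omega) C hm j d hjd (by omega), Nat.add_sub_cancel_left, inv_pow, mul_add r j i,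
      pow_add]
    have := hpos j
    field_simp

/-! ### Isotropic frames and the symplectic group -/

/-- If all nonempty fibres of `f` have the same cardinality, then `f` maps the uniform distribution to
the uniform distribution on its range. -/
theorem card_comp_mul {α β : Type*} [Finite α] [Finite β] (f : α → β) (R : β → Prop)
    (hR : ∀ a, R (f a)) {c : ℝ} (hc : ∀ b, R b → (Nat.card {a // f a = b} : ℝ) = c) (P : β → Prop) :
    (Nat.card {a // P (f a)} : ℝ) * Nat.card {b // R b} =
      Nat.card {b // R b ∧ P b} * Nat.card α := by
  have key : ∀ Q : β → Prop,
      (Nat.card {a // Q (f a)} : ℝ) = Nat.card {b // R b ∧ Q b} * c := by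
    intro Q
    have e : {a // Q (f a)} ≃ Σ b : {b // R b ∧ Q b}, {a // f a = b.1} :=
      { toFun := fun a => ⟨⟨f a.1, hR a.1, a.2⟩, ⟨a.1, rfl⟩⟩
        invFun := fun p => ⟨p.2.1, by rw [p.2.2]; exact p.1.2.2⟩
        left_inv := fun a => rfl
        right_inv := by
          rintro ⟨⟨b, hb⟩, ⟨a, ha⟩⟩
          change f a = b at ha
          subst ha
          rfl }
    rw [Nat.card_congr e, card_sigma_of_const (c := c)]
    exact fun b => hc b.1 b.2.1
  have h1 := key fun _ => True
  rw [Nat.card_congr (Equiv.subtypeUnivEquiv fun _ => trivial)] at h1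
  simp only [and_true] at h1
  rw [key P, h1]
  ring

section Frames

variable {k : Type*} [Field k] {g : ℕ}

theorem stdForm_swap (x y : Fin g ⊕ Fin g → k) : stdForm k g x y = -stdForm k g y x :=
  ((stdForm_isAlt k g).neg_eq y x).symm

/-- An isotropic frame: an independent family of pairwise orthogonal vectors. -/
def IsFrame {n : ℕ} (y : Fin n → (Fin g ⊕ Fin g → k)) : Prop :=
  LinearIndependent k y ∧ ∀ i j, stdForm k g (y i) (y j) = 0

theorem exists_dual_family {W : Type*} [AddCommGroup W] [Module k W] [FiniteDimensional k W]
    {B : LinearMap.BilinForm k W} (hB : B.Nondegenerate) {n : ℕ} {y : Fin n → W}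
    (hy : LinearIndependent k y) : ∃ z : Fin n → W, ∀ i j, B (y i) (z j) = if i = j then 1 else 0 := by
  obtain ⟨L, hL⟩ := (Fintype.linearCombination k y).exists_leftInverse_of_injective
    (LinearMap.ker_eq_bot.2 hy.fintypeLinearCombination_injective)
  refine ⟨fun j => (B.flip.toDual hB.flip).symm ((LinearMap.proj j).comp L), fun i j => ?_⟩
  have h := LinearMap.BilinForm.apply_toDual_symm_apply (hB := hB.flip)
    (f := (LinearMap.proj j).comp L) (v := y i)
  rw [LinearMap.BilinForm.flip_apply] at h
  rw [h]
  have h2 := LinearMap.congr_fun hL (Pi.single i 1)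
  rw [LinearMap.comp_apply, Fintype.linearCombination_apply_single, one_smul] at h2
  simp [h2, Pi.single_apply, eq_comm]

theorem mem_orthogonal_span {W : Type*} [AddCommGroup W] [Module k W]
    {B : LinearMap.BilinForm k W} {n : ℕ} {y : Fin n → W} {v : W} :
    v ∈ B.orthogonal (Submodule.span k (Set.range y)) ↔ ∀ i, B (y i) v = 0 := by
  have h : v ∈ B.orthogonal (Submodule.span k (Set.range y)) ↔
      Submodule.span k (Set.range y) ≤ LinearMap.ker (B.flip v) := Iff.rfl
  rw [h, Submodule.span_le, Set.range_subset_iff]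
  rfl

/-- The symplectic group acts transitively on the maximal isotropic frames: a frame is completed by a
dual family, and adding a strictly triangular combination of the frame to that family makes it
isotropic, in every characteristic. -/
theorem exists_symplectic_of_isFrame {y : Fin g → (Fin g ⊕ Fin g → k)} (hy : IsFrame y) :
    ∃ S : Sp (stdForm k g), ∀ i, S.1 (Pi.single (Sum.inl i) 1) = y i := by
  obtain ⟨z₀, hz₀⟩ := exists_dual_family (stdForm_nondegenerate k g) hy.1
  -- `X - Xᵀ` has to be the alternating Gram matrix of `z₀`; symmetrizing would require division by `2`.
  let X : Fin g → Fin g → k := fun l j => if l < j then stdForm k g (z₀ l) (z₀ j) else 0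
  let z : Fin g → (Fin g ⊕ Fin g → k) := fun j => z₀ j + ∑ l, X l j • y l
  have hyz : ∀ i j, stdForm k g (y i) (z j) = if i = j then 1 else 0 := fun i j => by
    simp [z, hz₀, hy.2]
  have hzy : ∀ i j, stdForm k g (z i) (y j) = if i = j then -1 else 0 := fun i j => by
    rw [stdForm_swap, hyz]
    by_cases h : i = j
    · simp [h]
    · simp [h, Ne.symm h]
  have hz : ∀ i j, stdForm k g (z i) (z j) = 0 := by
    intro i j
    have h1 : stdForm k g (z i) (z j) = stdForm k g (z₀ i) (z₀ j) + X j i - X i j := by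
      conv_lhs => rw [show z j = z₀ j + ∑ l, X l j • y l from rfl]
      rw [map_add, map_sum]
      simp only [map_smul, hzy]
      rw [show z i = z₀ i + ∑ l, X l i • y l from rfl]
      simp [hz₀, sub_eq_add_neg]
    rw [h1]
    simp only [X]
    rcases lt_trichotomy i j with h | rfl | h
    · rw [if_pos h, if_neg h.asymm]; ring
    · rw [(stdForm_isAlt k g) (z₀ i)]; simp
    · rw [if_pos h, if_neg h.asymm, stdForm_swap (z₀ i)]; ring
  let S₀ : (Fin g ⊕ Fin g → k) →ₗ[k] (Fin g ⊕ Fin g → k) :=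
    (Pi.basisFun k (Fin g ⊕ Fin g)).constr k (Sum.elim y z)
  have hS₀ : ∀ i, S₀ (Pi.single i 1) = Sum.elim y z i := fun i => by
    have := (Pi.basisFun k (Fin g ⊕ Fin g)).constr_basis k (Sum.elim y z) i
    rwa [Pi.basisFun_apply] at this
  have hform : (stdForm k g).compl₁₂ S₀ S₀ = stdForm k g := by
    refine LinearMap.BilinForm.ext_basis (Pi.basisFun k (Fin g ⊕ Fin g)) fun i j => ?_
    rw [LinearMap.compl₁₂_apply, Pi.basisFun_apply, Pi.basisFun_apply, hS₀, hS₀]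
    rcases i with i | i <;> rcases j with j | j <;>
      simp only [Sum.elim_inl, Sum.elim_inr, hy.2, hyz, hzy, hz, stdForm_apply]
    · simp
    · simp [Pi.single_apply, eq_comm]
    · simp only [Pi.single_apply, reduceCtorEq, if_false, Sum.inr.injEq, Sum.inl.injEq, zero_mul,
        zero_sub, ite_mul, one_mul, Finset.sum_neg_distrib]
      rw [Finset.sum_ite_eq' Finset.univ i]
      simp [apply_ite]
    · simp
  have hform' : ∀ x x', stdForm k g (S₀ x) (S₀ x') = stdForm k g x x' := fun x x' =>
    LinearMap.congr_fun (LinearMap.congr_fun hform x) x'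
  have hinj : Function.Injective S₀ := by
    rw [← LinearMap.ker_eq_bot, LinearMap.ker_eq_bot']
    intro x hx
    exact (stdForm_nondegenerate k g).1 x fun x' => by rw [← hform', hx, map_zero]; rfl
  exact ⟨⟨LinearEquiv.ofInjectiveEndo S₀ hinj, hform'⟩, fun i => hS₀ (Sum.inl i)⟩

/-- The images of the first `g` standard basis vectors under a symplectic automorphism. -/
def frameOf (C : Sp (stdForm k g)) : Fin g → (Fin g ⊕ Fin g → k) :=
  fun i => C.1 (Pi.single (Sum.inl i) 1)

theorem isFrame_single : IsFrame (k := k) fun i : Fin g => Pi.single (Sum.inl i) (1 : k) := by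
  constructor
  · have h := (Pi.basisFun k (Fin g ⊕ Fin g)).linearIndependent.comp _ Sum.inl_injective
    convert h using 1
    ext i
    simp
  · intro i j
    rw [stdForm_apply]
    simp

theorem isFrame_frameOf (C : Sp (stdForm k g)) : IsFrame (frameOf C) := by
  constructor
  · have h := (isFrame_single (k := k) (g := g)).1.map' C.1.toLinearMap
      (LinearMap.ker_eq_bot.2 C.1.injective)
    exact h
  · intro i j
    exact (C.2 _ _).trans ((isFrame_single (k := k) (g := g)).2 i j)

variable [Finite k]

instance finite_symplectic : Finite (Sp (stdForm k g)) :=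
  Finite.of_injective (fun S => (S.1 : (Fin g ⊕ Fin g → k) →ₗ[k] (Fin g ⊕ Fin g → k)))
    fun _ _ h => Subtype.ext (LinearEquiv.toLinearMap_injective h)

/-- The frame of a uniformly distributed symplectic automorphism is uniformly distributed. -/
theorem card_symplectic_mul (P : (Fin g → (Fin g ⊕ Fin g → k)) → Prop) :
    (Nat.card {C : Sp (stdForm k g) // P (frameOf C)} : ℝ) *
        Nat.card {y : Fin g → (Fin g ⊕ Fin g → k) // IsFrame y} =
      Nat.card {y : Fin g → (Fin g ⊕ Fin g → k) // IsFrame y ∧ P y} *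
        Nat.card (Sp (stdForm k g)) := by
  let c : ℝ := Nat.card {C : Sp (stdForm k g) // frameOf C = frameOf 1}
  have hc : ∀ y : Fin g → (Fin g ⊕ Fin g → k), IsFrame y →
      (Nat.card {C : Sp (stdForm k g) // frameOf C = y} : ℝ) = c := by
    intro y hy
    obtain ⟨S, hS⟩ := exists_symplectic_of_isFrame hy
    have hS' : y = fun i => S.1 (frameOf 1 i) := funext fun i => (hS i).symm
    refine congrArg Nat.cast (Nat.card_congr ((Equiv.mulLeft S).subtypeEquiv fun C => ?_)).symm
    rw [hS']
    constructor
    · intro h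
      rw [← h]
      rfl
    · intro h
      funext i
      exact S.1.injective (congrFun h i)
  exact card_comp_mul frameOf IsFrame isFrame_frameOf hc P

/-- A frame of `n` vectors is extended by any vector that is orthogonal to its span, a space of dimension
`2g - n`, but does not lie in the span. -/
theorem card_isFrame {n : ℕ} (hn : n ≤ g) :
    (Nat.card {y : Fin n → (Fin g ⊕ Fin g → k) // IsFrame y} : ℝ) =
      ∏ i ∈ Finset.range n, ((Nat.card k : ℝ) ^ (2 * g - i) - (Nat.card k : ℝ) ^ i) := by
  induction n with
  | zero =>
    have : Unique {y : Fin 0 → (Fin g ⊕ Fin g → k) // IsFrame y} :=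
      { default := ⟨Fin.elim0, linearIndependent_empty_type, fun i => i.elim0⟩
        uniq := fun y => Subtype.ext (Subsingleton.elim _ _) }
    simp
  | succ n ih =>
    have hcons : ∀ (v : Fin g ⊕ Fin g → k) (y : Fin n → (Fin g ⊕ Fin g → k)),
        IsFrame (Fin.cons v y : Fin (n + 1) → (Fin g ⊕ Fin g → k)) ↔
          IsFrame y ∧ (v ∈ (stdForm k g).orthogonal (Submodule.span k (Set.range y)) ∧
            v ∉ Submodule.span k (Set.range y)) := by
      intro v y
      rw [mem_orthogonal_span, IsFrame, IsFrame, linearIndependent_finCons]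
      simp only [Fin.forall_fin_succ, Fin.cons_zero, Fin.cons_succ]
      constructor
      · rintro ⟨⟨h1, h2⟩, -, h4⟩
        exact ⟨⟨h1, fun i => (h4 i).2⟩, fun i => (h4 i).1, h2⟩
      · rintro ⟨⟨h1, h2⟩, h3, h4⟩
        exact ⟨⟨h1, h4⟩, ⟨stdForm_isAlt k g v, fun i => by rw [stdForm_swap, h3, neg_zero]⟩,
          fun i => ⟨h3 i, h2 i⟩⟩
    let e : {y : Fin (n + 1) → (Fin g ⊕ Fin g → k) // IsFrame y} ≃
        Σ y : {y : Fin n → (Fin g ⊕ Fin g → k) // IsFrame y},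
          {v // v ∈ (stdForm k g).orthogonal (Submodule.span k (Set.range y.1)) ∧
            v ∉ Submodule.span k (Set.range y.1)} :=
      { toFun := fun y =>
          have h := (hcons (y.1 0) (Fin.tail y.1)).1 (by rw [Fin.cons_self_tail]; exact y.2)
          ⟨⟨Fin.tail y.1, h.1⟩, ⟨y.1 0, h.2⟩⟩
        invFun := fun p => ⟨Fin.cons p.2.1 p.1.1, (hcons _ _).2 ⟨p.1.2, p.2.2⟩⟩
        left_inv := fun y => Subtype.ext (Fin.cons_self_tail _)
        right_inv := fun p => rfl }
    rw [Nat.card_congr e, card_sigma_of_const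
      (c := (Nat.card k : ℝ) ^ (2 * g - n) - (Nat.card k : ℝ) ^ n), ih (by omega),
      Finset.prod_range_succ]
    rintro ⟨y, hy⟩
    have hle : Submodule.span k (Set.range y) ≤
        (stdForm k g).orthogonal (Submodule.span k (Set.range y)) := by
      rw [Submodule.span_le]
      rintro _ ⟨i, rfl⟩
      exact mem_orthogonal_span.2 fun j => hy.2 j i
    have hd := LinearMap.BilinForm.finrank_orthogonal (stdForm_nondegenerate k g)
      (Submodule.span k (Set.range y))
    have hs : finrank k (Submodule.span k (Set.range y)) = n := by
      simpa using finrank_span_eq_card hy.1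
    rw [hs, show finrank k (Fin g ⊕ Fin g → k) = 2 * g by simp [two_mul]] at hd
    have h1 : Nat.card (Submodule.span k (Set.range y)) = Nat.card k ^ n :=
      by
      rw [Module.natCard_eq_pow_finrank (K := k), hs]
    have h2 : Nat.card ((stdForm k g).orthogonal (Submodule.span k (Set.range y))) =
        Nat.card k ^ (2 * g - n) := by
      rw [Module.natCard_eq_pow_finrank (K := k), hd]
    have h3 := Set.ncard_sdiff_add_ncard_of_subset (SetLike.coe_subset_coe.2 hle) (Set.toFinite _)
    have h4 : Nat.card {v // v ∈ (stdForm k g).orthogonal (Submodule.span k (Set.range y)) ∧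
        v ∉ Submodule.span k (Set.range y)} + Nat.card k ^ n = Nat.card k ^ (2 * g - n) := by
      rw [← h1, ← h2]
      exact h3
    rw [eq_sub_iff_add_eq]
    exact_mod_cast h4

end Frames

/-! ### Isotropic frames with a given upper block -/

/-- A surjective homomorphism of finite groups maps the uniform distribution to the uniform
distribution. -/
theorem card_map_mul {A B : Type*} [AddCommGroup A] [AddCommGroup B] [Finite A] [Finite B]
    {f : A →+ B} (hf : Function.Surjective f) (P : B → Prop) :
    (Nat.card {a // P (f a)} : ℝ) * Nat.card B = Nat.card {b // P b} * Nat.card A := by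
  have h := card_comp_mul f (fun _ => True) (fun _ => trivial)
    (c := (Nat.card {a // f a = 0} : ℝ)) ?_ P
  · rw [Nat.card_congr (Equiv.subtypeUnivEquiv fun _ => trivial)] at h
    simpa only [true_and] using h
  · intro b _
    obtain ⟨a, rfl⟩ := hf b
    refine congrArg Nat.cast (Nat.card_congr ((Equiv.subRight a).subtypeEquiv fun x => ?_))
    simp [sub_eq_zero]

section Blocks

variable {k : Type*} [Field k] {g : ℕ}

theorem stdForm_elim (u u' v v' : Fin g → k) :
    stdForm k g (Sum.elim u u') (Sum.elim v v') = u ⬝ᵥ v' - u' ⬝ᵥ v := by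
  simp [stdForm_apply, dotProduct, Finset.sum_sub_distrib]

/-- The linear map `k ^ g → k ^ (2g)` with upper block `a` and lower block `c`. -/
def stack (a c : (Fin g → k) →ₗ[k] (Fin g → k)) : (Fin g → k) →ₗ[k] (Fin g ⊕ Fin g → k) where
  toFun u := Sum.elim (a u) (c u)
  map_add' u v := by
    ext i
    rcases i with i | i <;> simp
  map_smul' t u := by
    ext i
    rcases i with i | i <;> simp

theorem stack_apply (a c : (Fin g → k) →ₗ[k] (Fin g → k)) (u : Fin g → k) :
    stack a c u = Sum.elim (a u) (c u) := rfl

theorem stack_eq_zero {a c : (Fin g → k) →ₗ[k] (Fin g → k)} {u : Fin g → k} :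
    stack a c u = 0 ↔ a u = 0 ∧ c u = 0 := by
  rw [stack_apply, ← Sum.elim_zero_zero, Sum.elim_eq_iff]

theorem mulVecLin_surjective_of_linearIndependent {m : ℕ} {y : Fin m → (Fin g → k)} (hy : LinearIndependent k y) :
    Function.Surjective (Matrix.mulVecLin (Matrix.of y)) := by
  have hy' : LinearIndependent k fun i => stack LinearMap.id 0 (y i) := by
    refine hy.map' (stack LinearMap.id 0) (LinearMap.ker_eq_bot'.2 fun u hu => ?_)
    exact (stack_eq_zero.1 hu).1
  obtain ⟨z, hz⟩ := exists_dual_family (stdForm_nondegenerate k g) hy'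
  have hz' : ∀ i j, (y i) ⬝ᵥ (fun l => z j (Sum.inr l)) = if i = j then 1 else 0 := fun i j => by
    rw [← hz i j, stack_apply, ← Sum.elim_comp_inl_inr (z j), stdForm_elim]
    simp [Function.comp_def]
  intro t
  refine ⟨∑ j, t j • fun l => z j (Sum.inr l), ?_⟩
  ext i
  rw [map_sum]
  simp only [map_smul, Finset.sum_apply, Pi.smul_apply]
  rw [Finset.sum_eq_single i]
  · rw [Matrix.mulVecLin_apply]
    change t i • (y i ⬝ᵥ _) = t i
    rw [hz', if_pos rfl, smul_eq_mul, mul_one]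
  · intro j _ hj
    change t j • (y i ⬝ᵥ _) = 0
    rw [hz', if_neg hj.symm, smul_zero]
  · simp

theorem isotropic_iff_basis {ι : Type*} (b : Basis ι k (Fin g → k))
    (Y : (Fin g → k) →ₗ[k] (Fin g ⊕ Fin g → k)) :
    (∀ u v, stdForm k g (Y u) (Y v) = 0) ↔ ∀ i j, stdForm k g (Y (b i)) (Y (b j)) = 0 := by
  refine ⟨fun h i j => h _ _, fun h u v => ?_⟩
  have h0 : (stdForm k g).compl₁₂ Y Y = 0 := LinearMap.BilinForm.ext_basis b fun i j => h i j
  exact LinearMap.congr_fun (LinearMap.congr_fun h0 u) v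

theorem isFrame_iff (Y : (Fin g → k) →ₗ[k] (Fin g ⊕ Fin g → k)) :
    IsFrame (fun i => Y (Pi.basisFun k (Fin g) i)) ↔
      (∀ u v, stdForm k g (Y u) (Y v) = 0) ∧ ∀ x, Y x = 0 → x = 0 := by
  rw [IsFrame, isotropic_iff_basis (Pi.basisFun k (Fin g)), and_comm]
  refine and_congr_right fun _ => ⟨fun h x hx => ?_, fun h => ?_⟩
  · funext i
    refine Fintype.linearIndependent_iff.1 h x ?_ i
    simp only [← map_smul, ← map_sum]
    rw [← hx]
    congr 1
    exact (Pi.basisFun k (Fin g)).sum_repr x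
  · exact (Pi.basisFun k (Fin g)).linearIndependent.map' Y (LinearMap.ker_eq_bot'.2 h)

/-- The linear map `k ^ g → k ^ g` given by the upper halves of a family of `g` vectors. -/
noncomputable def upper (y : Fin g → (Fin g ⊕ Fin g → k)) : (Fin g → k) →ₗ[k] (Fin g → k) :=
  (Pi.basisFun k (Fin g)).constr k fun i j => y i (Sum.inl j)

theorem upper_basisFun (y : Fin g → (Fin g ⊕ Fin g → k)) (i : Fin g) :
    upper y (Pi.basisFun k (Fin g) i) = fun j => y i (Sum.inl j) :=
  (Pi.basisFun k (Fin g)).constr_basis k _ i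

/-- Families of `g` vectors in `k ^ (2g)` correspond to pairs of blocks. -/
noncomputable def blockEquiv : ((Fin g → k) →ₗ[k] (Fin g → k)) × ((Fin g → k) →ₗ[k] (Fin g → k)) ≃
    (Fin g → (Fin g ⊕ Fin g → k)) where
  toFun p i := stack p.1 p.2 (Pi.basisFun k (Fin g) i)
  invFun y := (upper y, (Pi.basisFun k (Fin g)).constr k fun i j => y i (Sum.inr j))
  left_inv p := by
    refine Prod.ext ((Pi.basisFun k (Fin g)).ext fun i => ?_)
      ((Pi.basisFun k (Fin g)).ext fun i => ?_)
    · exact upper_basisFun _ i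
    · exact (Pi.basisFun k (Fin g)).constr_basis k _ i
  right_inv y := by
    ext i j
    rcases j with j | j
    · exact congrFun (upper_basisFun y i) j
    · exact congrFun ((Pi.basisFun k (Fin g)).constr_basis k (fun i j => y i (Sum.inr j)) i) j

theorem upper_blockEquiv (p : ((Fin g → k) →ₗ[k] (Fin g → k)) × ((Fin g → k) →ₗ[k] (Fin g → k))) :
    upper (blockEquiv p) = p.1 := congrArg Prod.fst (blockEquiv.left_inv p)

/-- The condition on a lower block `c` to form an isotropic frame with the upper block `a`. -/
def IsLowerBlock (a c : (Fin g → k) →ₗ[k] (Fin g → k)) : Prop :=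
  (∀ u v, stdForm k g (stack a c u) (stack a c v) = 0) ∧ ∀ x ∈ LinearMap.ker a, c x = 0 → x = 0

theorem isFrame_blockEquiv_iff
    (p : ((Fin g → k) →ₗ[k] (Fin g → k)) × ((Fin g → k) →ₗ[k] (Fin g → k))) :
    IsFrame (blockEquiv p) ↔ IsLowerBlock p.1 p.2 := by
  refine (isFrame_iff (stack p.1 p.2)).trans (and_congr_right fun _ => forall_congr' fun x => ?_)
  rw [stack_eq_zero, and_imp, LinearMap.mem_ker]

variable [Finite k]

/-- Symmetric matrices are functions on unordered pairs of indices. -/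
theorem card_symmetric (m : ℕ) :
    Nat.card {B : Fin m → Fin m → k // ∀ i j, B i j = B j i} =
      Nat.card k ^ (m + 1).choose 2 := by
  rw [Nat.card_congr Sym2.lift, Nat.card_fun, Nat.card_eq_fintype_card (α := Sym2 (Fin m)),
    Sym2.card, Fintype.card_fin]

/-- In a basis adapted to the kernel of `a`, the lower block consists of a basis of the orthogonal
complement of the image of `a` and of a family whose pairings with the image of `a` are symmetric. -/
theorem card_isLowerBlock {r m : ℕ} (hg : g = r + m) (a : (Fin g → k) →ₗ[k] (Fin g → k))
    (ha : finrank k (LinearMap.ker a) = r) :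
    (Nat.card {c // IsLowerBlock a c} : ℝ) =
      injCount (Nat.card k) r r * (Nat.card k : ℝ) ^ ((m + 1).choose 2 + r * m) := by
  have hV : finrank k (Fin g → k) = r + m := by simp [hg]
  obtain ⟨b, hb⟩ := exists_basis_adapted (LinearMap.ker a) ha hV
  have hker : ∀ i, a (b (Sum.inl i)) = 0 := fun i => LinearMap.mem_ker.1 <|
    (hb _).2 ⟨Pi.single i 1, by simp [Pi.single_apply, ite_smul]⟩
  let y : Fin m → (Fin g → k) := fun i => a (b (Sum.inr i))
  have hy : LinearIndependent k y := by
    rw [Fintype.linearIndependent_iff]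
    intro t ht
    obtain ⟨t', ht'⟩ := (hb (∑ i, t i • b (Sum.inr i))).1 (by simpa [map_sum] using ht)
    have h := Fintype.linearIndependent_iff.1 b.linearIndependent (Sum.elim (-t') t)
      (by simp [Fintype.sum_sum_type, ht'])
    exact fun i => h (Sum.inr i)
  let ρ : (Fin g → k) →ₗ[k] (Fin m → k) := Matrix.mulVecLin (Matrix.of y)
  have hρ : ∀ w i, ρ w i = y i ⬝ᵥ w := fun w i => rfl
  have hρs : Function.Surjective ρ := mulVecLin_surjective_of_linearIndependent hy
  have hρk : finrank k (LinearMap.ker ρ) = r := by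
    have h := LinearMap.finrank_range_add_finrank_ker ρ
    rw [LinearMap.range_eq_top.2 hρs, finrank_top, hV, finrank_fin_fun] at h
    omega
  have hcond : ∀ c : (Fin g → k) →ₗ[k] (Fin g → k), IsLowerBlock a c ↔
      (LinearIndependent k (fun i => c (b (Sum.inl i))) ∧ ∀ i, c (b (Sum.inl i)) ∈ LinearMap.ker ρ) ∧
        ∀ i j, ρ (c (b (Sum.inr i))) j = ρ (c (b (Sum.inr j))) i := by
    intro c
    rw [IsLowerBlock, isotropic_iff_basis b, linearIndependent_map_iff b hb c]
    simp only [stack_apply, stdForm_elim, Sum.forall, hker, hρ, LinearMap.mem_ker, funext_iff,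
      zero_dotProduct, dotProduct_zero, sub_eq_zero, Pi.zero_apply]
    constructor
    · rintro ⟨⟨-, h2⟩, h3⟩
      exact ⟨⟨h3, fun i j => (h2 j).1 i⟩, fun i j => by
        rw [(h2 j).2 i, dotProduct_comm]⟩
    · rintro ⟨⟨h1, h2⟩, h3⟩
      exact ⟨⟨fun i => ⟨fun _ => trivial, fun j => by
          rw [dotProduct_comm]; exact (h2 i j).symm⟩,
        fun i => ⟨fun j => h2 j i, fun j => by rw [dotProduct_comm (c _)]; exact h3 j i⟩⟩, h1⟩
  have e1 : {c // IsLowerBlock a c} ≃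
      {v : Fin r → (Fin g → k) // LinearIndependent k v ∧ ∀ i, v i ∈ LinearMap.ker ρ} ×
        {w : Fin m → (Fin g → k) // ∀ i j, ρ (w i) j = ρ (w j) i} :=
    calc {c // IsLowerBlock a c}
      _ ≃ {w : Fin r ⊕ Fin m → (Fin g → k) //
            (LinearIndependent k (fun i => w (Sum.inl i)) ∧ ∀ i, w (Sum.inl i) ∈ LinearMap.ker ρ) ∧
              ∀ i j, ρ (w (Sum.inr i)) j = ρ (w (Sum.inr j)) i} :=
          (semilinearConstr (σ := RingHom.id k) b).subtypeEquiv hcond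
      _ ≃ {w : (Fin r → (Fin g → k)) × (Fin m → (Fin g → k)) //
            (LinearIndependent k w.1 ∧ ∀ i, w.1 i ∈ LinearMap.ker ρ) ∧
              ∀ i j, ρ (w.2 i) j = ρ (w.2 j) i} :=
          (Equiv.sumArrowEquivProdArrow (Fin r) (Fin m) (Fin g → k)).subtypeEquiv fun _ => Iff.rfl
      _ ≃ _ := Equiv.subtypeProdEquivProd
          (p := fun v : Fin r → (Fin g → k) => LinearIndependent k v ∧ ∀ i, v i ∈ LinearMap.ker ρ)
          (q := fun w : Fin m → (Fin g → k) => ∀ i j, ρ (w i) j = ρ (w j) i)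
  have e2 : {v : Fin r → (Fin g → k) // LinearIndependent k v ∧ ∀ i, v i ∈ LinearMap.ker ρ} ≃
      {v : Fin r → LinearMap.ker ρ // LinearIndependent k v} :=
    { toFun := fun v => ⟨fun i => ⟨v.1 i, v.2.2 i⟩,
        LinearIndependent.of_comp (LinearMap.ker ρ).subtype v.2.1⟩
      invFun := fun v => ⟨fun i => v.1 i, v.2.map' _ (LinearMap.ker ρ).ker_subtype,
        fun i => (v.1 i).2⟩
      left_inv := fun v => rfl
      right_inv := fun v => rfl }
  let Φ : (Fin m → (Fin g → k)) →+ (Fin m → Fin m → k) :=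
    { toFun := fun w i => ρ (w i)
      map_zero' := by ext; simp
      map_add' := fun w w' => by ext; simp }
  have hΦ : Function.Surjective Φ := fun B => by
    choose w hw using fun i => hρs (B i)
    exact ⟨w, funext hw⟩
  have h3 := card_map_mul hΦ fun B => ∀ i j, B i j = B j i
  have hq : (Nat.card k : ℝ) ≠ 0 := (zero_lt_one.trans (one_lt_card_real (k := k))).ne'
  rw [card_symmetric] at h3
  simp only [Nat.card_fun, Nat.card_fin, Nat.cast_pow] at h3
  have h4 : (Nat.card {w : Fin m → (Fin g → k) // ∀ i j, ρ (w i) j = ρ (w j) i} : ℝ) =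
      (Nat.card k : ℝ) ^ ((m + 1).choose 2 + r * m) := by
    apply mul_right_cancel₀ (pow_ne_zero m (pow_ne_zero m hq))
    refine h3.trans ?_
    rw [hg]
    ring
  rw [Nat.card_congr e1, Nat.card_prod, Nat.card_congr e2, Nat.cast_mul, card_linearIndependent_eq,
    hρk, h4]

/-- The number of frames whose upper block has a given property that forces its nullity. -/
theorem card_isFrame_upper {r m : ℕ} (hg : g = r + m)
    {P : ((Fin g → k) →ₗ[k] (Fin g → k)) → Prop} (hP : ∀ a, P a → finrank k (LinearMap.ker a) = r) :
    (Nat.card {y : Fin g → (Fin g ⊕ Fin g → k) // IsFrame y ∧ P (upper y)} : ℝ) =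
      Nat.card {a // P a} *
        (injCount (Nat.card k) r r * (Nat.card k : ℝ) ^ ((m + 1).choose 2 + r * m)) := by
  have e : {y : Fin g → (Fin g ⊕ Fin g → k) // IsFrame y ∧ P (upper y)} ≃
      Σ a : {a // P a}, {c // IsLowerBlock a.1 c} :=
    (blockEquiv.symm.subtypeEquiv fun y => by
      obtain ⟨p, rfl⟩ := blockEquiv.surjective y
      rw [isFrame_blockEquiv_iff, upper_blockEquiv, Equiv.symm_apply_apply]).trans
    { toFun := fun p : {p : ((Fin g → k) →ₗ[k] (Fin g → k)) × ((Fin g → k) →ₗ[k] (Fin g → k)) //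
          IsLowerBlock p.1 p.2 ∧ P p.1} => ⟨⟨p.1.1, p.2.2⟩, ⟨p.1.2, p.2.1⟩⟩
      invFun := fun p => ⟨(p.1.1, p.2.1), p.2.2, p.1.2⟩
      left_inv := fun p => rfl
      right_inv := fun p => rfl }
  rw [Nat.card_congr e, card_sigma_of_const]
  exact fun a => card_isLowerBlock hg a.1 (hP a.1 a.2)

end Blocks

/-! ### Reduction to the upper block of a random symplectic matrix -/

section CompComm

variable {k : Type*} [Field k] {σ : k →+* k} [RingHomSurjective σ]
variable {V V' : Type*} [AddCommGroup V] [Module k V] [AddCommGroup V'] [Module k V']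

theorem finrank_ker_inf_range_comp {α : V →ₛₗ[σ] V'} {β : V' →ₗ[k] V}
    (hα : Function.Surjective α) (hβ : Function.Injective β) :
    finrank k (LinearMap.ker (β.comp α : V →ₛₗ[σ] V) ⊓ LinearMap.range (β.comp α : V →ₛₗ[σ] V) :
      Submodule k V) = finrank k (LinearMap.ker (α.comp β : V' →ₛₗ[σ] V')) := by
  have h : LinearMap.ker (β.comp α : V →ₛₗ[σ] V) ⊓ LinearMap.range (β.comp α : V →ₛₗ[σ] V) =
      (LinearMap.ker (α.comp β : V' →ₛₗ[σ] V')).map β := by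
    ext x
    simp only [Submodule.mem_inf, LinearMap.mem_ker, LinearMap.mem_range, Submodule.mem_map,
      LinearMap.comp_apply, map_eq_zero_iff β hβ]
    constructor
    · rintro ⟨h1, y, rfl⟩
      exact ⟨α y, h1, rfl⟩
    · rintro ⟨v, hv, rfl⟩
      obtain ⟨y, rfl⟩ := hα v
      exact ⟨hv, y, rfl⟩
  rw [h]
  exact (Submodule.equivMapOfInjective β hβ _).finrank_eq.symm

end CompComm

section Coordinates

variable {k : Type*} [Field k] {g : ℕ}

/-- The coordinatewise action of `σ` on `k ^ g`. -/
def coordMap (σ : k →+* k) (g : ℕ) : (Fin g → k) →ₛₗ[σ] (Fin g → k) where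
  toFun v i := σ (v i)
  map_add' u v := by ext; simp
  map_smul' c v := by ext; simp

theorem coordMap_injective (σ : k →+* k) : Function.Injective (coordMap σ g) := fun _ _ h =>
  funext fun i => σ.injective (congrFun h i)

theorem coordMap_surjective (σ : k →+* k) [RingHomSurjective σ] :
    Function.Surjective (coordMap σ g) := fun v => by
  choose w hw using fun i => RingHomSurjective.is_surjective (σ := σ) (v i)
  exact ⟨w, funext hw⟩

theorem coordMap_basisFun (σ : k →+* k) (i : Fin g) :
    coordMap σ g (Pi.basisFun k (Fin g) i) = Pi.basisFun k (Fin g) i := by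
  ext j
  simp [coordMap, Pi.single_apply, apply_ite σ]

/-- The inclusion of the first `g` coordinates. -/
def embed (k : Type*) [Field k] (g : ℕ) : (Fin g → k) →ₗ[k] (Fin g ⊕ Fin g → k) :=
  stack LinearMap.id 0

/-- The projection to the first `g` coordinates. -/
def proj (k : Type*) [Field k] (g : ℕ) : (Fin g ⊕ Fin g → k) →ₗ[k] (Fin g → k) :=
  LinearMap.funLeft k k Sum.inl

theorem embed_injective : Function.Injective (embed k g) :=
  LinearMap.ker_eq_bot.1 <| LinearMap.ker_eq_bot'.2 fun _ hu => (stack_eq_zero.1 hu).1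

theorem proj_surjective : Function.Surjective (proj k g) := fun v => ⟨embed k g v, rfl⟩

theorem embed_basisFun (i : Fin g) :
    embed k g (Pi.basisFun k (Fin g) i) = Pi.single (Sum.inl i) 1 := by
  ext j
  rcases j with j | j <;> simp [embed, stack_apply, Pi.single_apply]

theorem upper_frameOf (C : Sp (stdForm k g)) :
    upper (frameOf C) = (proj k g).comp (C.1.toLinearMap.comp (embed k g)) := by
  refine (Pi.basisFun k (Fin g)).ext fun i => ?_
  rw [upper_basisFun, LinearMap.comp_apply, LinearMap.comp_apply, embed_basisFun]
  rfl

/-- The symplectic automorphism that exchanges the two halves of the coordinates. -/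
def swapSp (k : Type*) [Field k] (g : ℕ) : Sp (stdForm k g) :=
  ⟨{ toFun := fun x => Sum.elim (fun i => x (Sum.inr i)) (fun i => -x (Sum.inl i))
     invFun := fun x => Sum.elim (fun i => -x (Sum.inr i)) (fun i => x (Sum.inl i))
     map_add' := fun x y => by
       ext j
       rcases j with j | j
       · rfl
       · simp [add_comm]
     map_smul' := fun c x => by ext j; rcases j with j | j <;> simp
     left_inv := fun x => by ext j; rcases j with j | j <;> simp
     right_inv := fun x => by ext j; rcases j with j | j <;> simp }, fun x y => by
    rw [stdForm_apply, stdForm_apply]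
    refine Finset.sum_congr rfl fun i _ => ?_
    change x (Sum.inr i) * -y (Sum.inl i) - -x (Sum.inl i) * y (Sum.inr i) = _
    ring⟩

theorem swapSp_single (i : Fin g) :
    (swapSp k g).1 (Pi.single (Sum.inr i) 1) = Pi.single (Sum.inl i) 1 := by
  ext j
  change Sum.elim _ _ j = _
  rcases j with j | j <;> simp [Pi.single_apply]

end Coordinates

section NormalForm

variable {p : ℕ} [Fact p.Prime] {k : Type*} [Field k] [Finite k] [CharP k p] {g : ℕ}

/-- The range of `V` is its own orthogonal complement, so the kernel of `F` is Lagrangian. -/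
theorem orthogonal_ker_F {M : PQPDBT1 p k (Fin g ⊕ Fin g → k)} (hω : M.ω = stdForm k g) :
    (stdForm k g).orthogonal (LinearMap.ker M.F) = LinearMap.ker M.F := by
  have h1 : ∀ x y, stdForm k g (M.F x) y = sigma p k (stdForm k g x (M.V y)) := hω ▸ M.form_F
  ext y
  rw [LinearMap.BilinForm.mem_orthogonal_iff, LinearMap.mem_ker, ← M.range_V]
  constructor
  · intro h
    refine (stdForm_nondegenerate k g).1 _ fun x => ?_
    rw [h1, stdForm_swap, show stdForm k g (M.V x) y = 0 from h _ ⟨x, rfl⟩, neg_zero, map_zero]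
  · rintro h _ ⟨x, rfl⟩
    refine (map_eq_zero (sigma p k)).1 ?_
    rw [stdForm_swap, map_neg, ← h1, h, map_zero, LinearMap.zero_apply, neg_zero]

/-- Up to symplectic automorphisms on both sides, every Frobenius is the standard one, which
applies `σ` to the first half of the coordinates and kills the second half. -/
theorem exists_normal_form {M : PQPDBT1 p k (Fin g ⊕ Fin g → k)} (hω : M.ω = stdForm k g) :
    ∃ S T : Sp (stdForm k g), ∀ x,
      M.F (T.1 x) = S.1 (embed k g (coordMap (sigma p k) g (proj k g x))) := by
  have hK := orthogonal_ker_F hω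
  have hform : ∀ x y, stdForm k g (M.F x) y = sigma p k (stdForm k g x (M.V y)) := hω ▸ M.form_F
  have hKd : finrank k (LinearMap.ker M.F) = g := by
    have h := LinearMap.BilinForm.finrank_orthogonal (stdForm_nondegenerate k g) (LinearMap.ker M.F)
    have h2 := Submodule.finrank_le (LinearMap.ker M.F)
    have h3 : finrank k (Fin g ⊕ Fin g → k) = 2 * g := by simp [two_mul]
    rw [hK] at h
    omega
  let b := finBasisOfFinrankEq k (LinearMap.ker M.F) hKd
  have hz : IsFrame fun i => (b i : Fin g ⊕ Fin g → k) := by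
    refine ⟨?_, fun i j => ?_⟩
    · have h := b.linearIndependent.map' (LinearMap.ker M.F).subtype (Submodule.ker_subtype _)
      exact h
    exact hK.ge (b j).2 _ (b i).2
  obtain ⟨S₁, hS₁⟩ := exists_symplectic_of_isFrame hz
  let T : Sp (stdForm k g) := S₁ * swapSp k g
  have hT : ∀ i, T.1 (Pi.single (Sum.inr i) 1) = b i := fun i => by
    change S₁.1 ((swapSp k g).1 _) = _
    rw [swapSp_single, hS₁]
  have hTF : ∀ i, M.F (T.1 (Pi.single (Sum.inr i) 1)) = 0 := fun i => by
    rw [hT]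
    exact (b i).2
  have hTe : ∀ d : Fin g → k, M.F (T.1 (embed k g d)) = 0 → d = 0 := by
    intro d hd
    obtain ⟨c, hc⟩ : ∃ c : Fin g → k, T.1 (embed k g d) = T.1 (∑ i, c i • Pi.single (Sum.inr i) 1) := by
      refine ⟨b.repr ⟨_, hd⟩, ?_⟩
      have h := congrArg (LinearMap.ker M.F).subtype (b.sum_repr ⟨_, hd⟩)
      rw [map_sum] at h
      rw [map_sum]
      simp only [map_smul, hT]
      exact h.symm
    have h2 := congrArg (proj k g) (T.1.injective hc)
    rw [map_sum] at h2
    refine h2.trans (Finset.sum_eq_zero fun i _ => ?_)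
    rw [map_smul]
    ext j
    simp [proj, LinearMap.funLeft_apply]
  have hy : IsFrame fun i => M.F (T.1 (embed k g (Pi.basisFun k (Fin g) i))) := by
    constructor
    · rw [Fintype.linearIndependent_iff]
      intro c hc i
      obtain ⟨d, rfl⟩ := coordMap_surjective (g := g) (sigma p k) c
      have h : M.F (T.1 (embed k g d)) = 0 := by
        rw [← hc]
        conv_lhs => rw [← (Pi.basisFun k (Fin g)).sum_repr d]
        simp only [map_sum, map_smul, map_smulₛₗ]
        rfl
      rw [hTe d h, map_zero]
      rfl
    · intro i j
      have h0 : M.V (M.F (T.1 (embed k g (Pi.basisFun k (Fin g) j)))) = 0 := by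
        rw [← LinearMap.mem_ker, ← M.range_F]
        exact ⟨_, rfl⟩
      rw [hform, h0, map_zero, map_zero]
  obtain ⟨S, hS⟩ := exists_symplectic_of_isFrame hy
  refine ⟨S, T, fun x => ?_⟩
  have hext : M.F.comp T.1.toLinearMap =
      S.1.toLinearMap.comp ((embed k g).comp ((coordMap (sigma p k) g).comp (proj k g))) := by
    refine (Pi.basisFun k (Fin g ⊕ Fin g)).ext fun i => ?_
    rw [Pi.basisFun_apply]
    simp only [LinearMap.comp_apply, LinearEquiv.coe_coe]
    rcases i with i | i
    · have h1 : proj k g (Pi.single (Sum.inl i) 1) = Pi.basisFun k (Fin g) i := by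
        rw [← embed_basisFun]
        rfl
      rw [h1, coordMap_basisFun, embed_basisFun, hS, embed_basisFun]
    · have h1 : proj k g (Pi.single (Sum.inr i) 1) = 0 := by
        ext j
        simp [proj, LinearMap.funLeft_apply]
      rw [hTF, h1, map_zero, map_zero, map_zero]
  exact LinearMap.congr_fun hext x

/-- The property of the upper block `a` of a symplectic matrix that corresponds to `a`-number `r` and
`p`-corank `s`. -/
def BlockProp (σ : k →+* k) (g r s : ℕ) [RingHomSurjective σ]
    (a : (Fin g → k) →ₗ[k] (Fin g → k)) : Prop :=
  finrank k (LinearMap.ker ((coordMap σ g).comp a)) = r ∧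
    g - stableRank ((coordMap σ g).comp a) = s

theorem finrank_ker_of_blockProp {σ : k →+* k} [RingHomSurjective σ] {r s : ℕ}
    {a : (Fin g → k) →ₗ[k] (Fin g → k)} (h : BlockProp σ g r s a) :
    finrank k (LinearMap.ker a) = r := by
  rw [← h.1, LinearMap.ker_comp_of_ker_eq_bot _ (LinearMap.ker_eq_bot.2 (coordMap_injective σ))]

theorem card_blockProp (σ : k →+* k) [RingHomSurjective σ] {r s : ℕ} (hrs : r ≤ s) (hs : s ≤ g) :
    (Nat.card {a // BlockProp σ g r s a} : ℝ) =
      injCount (Nat.card k) g g * phi (Nat.card k : ℝ)⁻¹ r s / injCount (Nat.card k) r r := by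
  rw [← card_semilinear_end (σ := σ) g (Fin g → k) (by simp) r s hrs hs]
  have hb : Function.Bijective fun a : (Fin g → k) →ₗ[k] (Fin g → k) => (coordMap σ g).comp a := by
    constructor
    · intro a a' h
      exact LinearMap.ext fun x => coordMap_injective σ (LinearMap.congr_fun h x)
    · intro T
      choose w hw using fun i => coordMap_surjective σ (T (Pi.basisFun k (Fin g) i))
      refine ⟨(Pi.basisFun k (Fin g)).constr k w, (Pi.basisFun k (Fin g)).ext fun i => ?_⟩
      change coordMap σ g ((Pi.basisFun k (Fin g)).constr k w (Pi.basisFun k (Fin g) i)) = _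
      rw [Basis.constr_basis, hw]
  exact congrArg Nat.cast (Nat.card_congr ((Equiv.ofBijective _ hb).subtypeEquiv fun a => Iff.rfl))

/-- The Frobenius `A F₀ B` is `β ∘ α` for an injection `β : k ^ g → k ^ (2g)` and a surjection `α` in
the other direction, and `α ∘ β` is, up to `σ`, the upper block of a symplectic automorphism. -/
theorem translate_iff_blockProp {M : PQPDBT1 p k (Fin g ⊕ Fin g → k)} {S T : Sp (stdForm k g)} (hST : ∀ x,
      M.F (T.1 x) = S.1 (embed k g (coordMap (sigma p k) g (proj k g x))))
    {D : PQPDBT1 p k (Fin g ⊕ Fin g → k)} {A B : Sp (stdForm k g)}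
    (hD : ∀ x, D.F x = A.1 (M.F (B.1 x))) (r s : ℕ) :
    (D.aNumber = r ∧ D.pCorank = s) ↔
      BlockProp (sigma p k) g r s (upper (frameOf (T⁻¹ * B * A * S))) := by
  let U : Sp (stdForm k g) := A * S
  let C : Sp (stdForm k g) := T⁻¹ * B * A * S
  let α : (Fin g ⊕ Fin g → k) →ₛₗ[sigma p k] (Fin g → k) :=
    (coordMap (sigma p k) g).comp ((proj k g).comp (C * U⁻¹).1.toLinearMap)
  let β : (Fin g → k) →ₗ[k] (Fin g ⊕ Fin g → k) := U.1.toLinearMap.comp (embed k g)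
  have hCU : C * U⁻¹ = T⁻¹ * B := by simp only [C, U]; group
  -- `A F₀ B = A S F_std T⁻¹ B`, where `A S = U` and `T⁻¹ B = C U⁻¹`.
  have hF : D.F = β.comp α := by
    ext1 x
    rw [hD]
    have h1 : B.1 x = T.1 ((C * U⁻¹).1 x) := by
      change B.1 x = (T * (C * U⁻¹)).1 x
      rw [hCU, mul_inv_cancel_left]
    rw [h1, hST]
    rfl
  have hαβ : α.comp β = (coordMap (sigma p k) g).comp (upper (frameOf C)) := by
    rw [upper_frameOf]
    ext1 x
    have h1 : (C * U⁻¹).1 (U.1 (embed k g x)) = C.1 (embed k g x) := by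
      change (C * U⁻¹ * U).1 (embed k g x) = _
      rw [inv_mul_cancel_right]
    exact congrArg (fun y => coordMap (sigma p k) g (proj k g y)) h1
  have hα : Function.Surjective α := (coordMap_surjective (sigma p k)).comp
    (proj_surjective.comp (C * U⁻¹).1.surjective)
  have hβ : Function.Injective β := U.1.injective.comp embed_injective
  have ha : D.aNumber = finrank k
      (LinearMap.ker ((coordMap (sigma p k) g).comp (upper (frameOf C)))) := by
    rw [PQPDBT1.aNumber, ← D.range_F, hF, finrank_ker_inf_range_comp hα hβ, hαβ]
  have hs : D.pCorank = g - stableRank ((coordMap (sigma p k) g).comp (upper (frameOf C))) := by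
    have h1 : D.pRank = stableRank D.F := rfl
    rw [PQPDBT1.pCorank, h1, hF, stableRank_comp_comm, hαβ]
    congr 1
    simp
    omega
  rw [ha, hs]
  rfl

/-- A condition on the second component of a pair leaves the first component free. -/
def subtypeSndEquiv {α β : Type*} (P : β → Prop) : {x : α × β // P x.2} ≃ α × {b // P b} where
  toFun x := (x.1.1, ⟨x.1.2, x.2⟩)
  invFun x := ⟨(x.1, x.2.1), x.2.2⟩
  left_inv _ := rfl
  right_inv _ := rfl

theorem translate_F {W : Type*} [AddCommGroup W] [Module k W] (M : PQPDBT1 p k W) (A B : Sp M.ω)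
    (x : W) : (M.translate A B).F x = A.1 (M.F (B.1 x)) := rfl

/-- With `F₀ = S F_std T⁻¹`, the substitution `(A, B) ↦ (A, T⁻¹ B A S)` shows that only the second
component, which is again uniformly distributed, matters. -/
theorem prob_eq (M₀ : PQPDieudonne p k g) (r s : ℕ) :
    M₀.prob (fun D => D.aNumber = r ∧ D.pCorank = s) =
      (Nat.card {C : Sp (stdForm k g) // BlockProp (sigma p k) g r s (upper (frameOf C))} : ℝ) /
        Nat.card (Sp (stdForm k g)) := by
  obtain ⟨S, T, hST⟩ := exists_normal_form (M := M₀.reduction) rfl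
  have hiff : ∀ A B : Sp (stdForm k g), ((M₀.reduction.translate A B).aNumber = r ∧
      (M₀.reduction.translate A B).pCorank = s) ↔
      BlockProp (sigma p k) g r s (upper (frameOf (T⁻¹ * B * A * S))) := fun A B =>
    translate_iff_blockProp (D := M₀.reduction.translate A B) hST
      (translate_F M₀.reduction A B) r s
  let e : Sp (stdForm k g) × Sp (stdForm k g) ≃ Sp (stdForm k g) × Sp (stdForm k g) :=
    { toFun := fun AB => (AB.1, T⁻¹ * AB.2 * AB.1 * S)
      invFun := fun AC => (AC.1, T * AC.2 * S⁻¹ * AC.1⁻¹)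
      left_inv := fun AB => Prod.ext rfl (by group)
      right_inv := fun AC => Prod.ext rfl (by group) }
  have he : ∀ AB, (e AB).2 = T⁻¹ * AB.2 * AB.1 * S := fun AB => rfl
  have e1 : {AB : Sp (stdForm k g) × Sp (stdForm k g) //
      (M₀.reduction.translate AB.1 AB.2).aNumber = r ∧
        (M₀.reduction.translate AB.1 AB.2).pCorank = s} ≃
      {AC : Sp (stdForm k g) × Sp (stdForm k g) //
        BlockProp (sigma p k) g r s (upper (frameOf AC.2))} := by
    refine Equiv.subtypeEquiv e fun AB => ?_
    rw [he AB]
    exact hiff AB.1 AB.2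
  have e2 := subtypeSndEquiv (α := Sp (stdForm k g)) fun C : Sp (stdForm k g) =>
    BlockProp (sigma p k) g r s (upper (frameOf C))
  have hne : (Nat.card (Sp (stdForm k g)) : ℝ) ≠ 0 := by
    have : Nonempty (Sp (stdForm k g)) := ⟨1⟩
    have : Finite (Sp (stdForm k g)) := finite_symplectic
    have := Nat.card_pos (α := Sp (stdForm k g))
    positivity
  rw [PQPDieudonne.prob, Nat.card_congr (e1.trans e2), Nat.card_prod, Nat.card_prod, Nat.cast_mul,
    Nat.cast_mul, mul_div_mul_left _ _ hne]

end NormalForm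

/-! ### The exact probability and its limit -/

theorem choose_two_add (r m : ℕ) :
    (r + m + 1).choose 2 = (r + 1).choose 2 + ((m + 1).choose 2 + r * m) := by
  have h : ((r + m + 1).choose 2 : ℚ) = ((r + 1).choose 2 + ((m + 1).choose 2 + r * m) : ℕ) := by
    push_cast [Nat.cast_choose_two]
    ring
  exact_mod_cast h

/-- The number of isotropic frames, compared with the order of `GL_g`. -/
theorem prod_frames_eq {q : ℝ} (hq : q ≠ 0) (g : ℕ) :
    ∏ i ∈ Finset.range g, (q ^ (2 * g - i) - q ^ i) =
      injCount q g g * (q ^ (g + 1).choose 2 * ∏ i ∈ Finset.range g, (1 + q⁻¹ ^ (i + 1))) := by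
  have h1 : q ^ (g + 1).choose 2 * ∏ i ∈ Finset.range g, (1 + q⁻¹ ^ (i + 1)) =
      ∏ i ∈ Finset.range g, (q ^ (i + 1) + 1) := by
    induction g with
    | zero => simp
    | succ g ih =>
      rw [Finset.prod_range_succ, Finset.prod_range_succ, ← ih, Nat.choose_succ_succ (g + 1) 1,
        Nat.choose_one_right, pow_add]
      have : q ^ (g + 1) ≠ 0 := pow_ne_zero _ hq
      rw [inv_pow]
      field_simp
  rw [h1, ← Finset.prod_range_reflect fun i => q ^ (i + 1) + 1, injCount, ← Finset.prod_mul_distrib]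
  refine Finset.prod_congr rfl fun i hi => ?_
  obtain ⟨e, rfl⟩ := Nat.exists_eq_add_of_lt (Finset.mem_range.1 hi)
  rw [show 2 * (i + e + 1) - i = i + (e + 1) + (e + 1) by omega,
    show i + e + 1 - 1 - i + 1 = e + 1 by omega]
  ring

/-- The probability is given by an exact formula as soon as `g` is at least the `p`-corank. -/
theorem prob_formula {p : ℕ} [Fact p.Prime] {k : Type*} [Field k] [Finite k] [CharP k p] {g r s : ℕ}
    (hrs : r ≤ s) (hs : s ≤ g) (M₀ : PQPDieudonne p k g) :
    M₀.prob (fun D => D.aNumber = r ∧ D.pCorank = s) =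
      (Nat.card k : ℝ)⁻¹ ^ (r + 1).choose 2 *
        (∏ i ∈ Finset.range g, (1 + (Nat.card k : ℝ)⁻¹ ^ (i + 1))⁻¹) *
          phi (Nat.card k : ℝ)⁻¹ r s := by
  obtain ⟨m, rfl⟩ := Nat.exists_eq_add_of_le (hrs.trans hs)
  have hq := one_lt_card_real (k := k)
  have hq0 : (0 : ℝ) < Nat.card k := zero_lt_one.trans hq
  have h1 := card_symplectic_mul (k := k) (g := r + m) fun y =>
    BlockProp (sigma p k) (r + m) r s (upper y)
  rw [card_isFrame_upper rfl fun a ha => finrank_ker_of_blockProp ha, card_blockProp _ hrs hs,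
    card_isFrame le_rfl, prod_frames_eq hq0.ne'] at h1
  have hS : (Nat.card (Sp (stdForm k (r + m))) : ℝ) ≠ 0 := by
    have : Nonempty (Sp (stdForm k (r + m))) := ⟨1⟩
    have : Finite (Sp (stdForm k (r + m))) := finite_symplectic
    have := Nat.card_pos (α := Sp (stdForm k (r + m)))
    positivity
  have hr := (injCount_pos hq (le_refl r)).ne'
  have hg := (injCount_pos hq (le_refl (r + m))).ne'
  have hP : ∏ i ∈ Finset.range (r + m), (1 + (Nat.card k : ℝ)⁻¹ ^ (i + 1)) ≠ 0 :=
    (Finset.prod_pos fun i _ => by positivity).ne'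
  have hc := (pow_pos hq0 ((r + 1).choose 2)).ne'
  have hc' := (pow_pos hq0 ((m + 1).choose 2 + r * m)).ne'
  rw [choose_two_add, pow_add] at h1
  rw [prob_eq, div_eq_iff hS, Finset.prod_inv_distrib, inv_pow]
  field_simp at h1 ⊢
  linear_combination h1

theorem multipliable_inv_one_add {x : ℝ} (h0 : 0 < x) (h1 : x < 1) :
    Multipliable fun i : ℕ => (1 + x ^ (i + 1))⁻¹ := by
  have h : Summable fun i : ℕ => ‖-(x ^ (i + 1) * (1 + x ^ (i + 1))⁻¹)‖ := by
    refine Summable.of_nonneg_of_le (fun _ => norm_nonneg _) (fun i => ?_)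
      ((summable_nat_add_iff 1).2 (summable_geometric_of_lt_one h0.le h1))
    have h2 : 0 < x ^ (i + 1) := pow_pos h0 _
    rw [norm_neg, Real.norm_of_nonneg (by positivity)]
    exact mul_le_of_le_one_right h2.le (inv_le_one_of_one_le₀ (by linarith))
  refine (multipliable_one_add_of_summable h).congr fun i => ?_
  have h2 : 0 < 1 + x ^ (i + 1) := by positivity
  field_simp
  ring

end RandomDBT

theorem propositionp (p : ℕ) [Fact p.Prime] (k : Type*) [Field k] [Finite k] [CharP k p]
    (q : ℕ) (hq : q = Nat.card k) (r s : ℕ) (hrs : r ≤ s)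
    (M₀ : ∀ g : ℕ, RandomDBT.PQPDieudonne p k g) :
    Multipliable (fun i : ℕ => (1 + (q : ℝ) ^ (-((i : ℤ) + 1)))⁻¹) ∧
    Filter.Tendsto (fun g : ℕ => (M₀ g).prob (fun D => D.aNumber = r ∧ D.pCorank = s)) Filter.atTop
      (nhds ((q : ℝ) ^ (-(((r + 1).choose 2 : ℕ) : ℤ) + (r : ℤ) - (s : ℤ)) *
        (∏' i : ℕ, (1 + (q : ℝ) ^ (-((i : ℤ) + 1)))⁻¹) *
        (∏ i ∈ Finset.Ico r s, (1 - (q : ℝ) ^ (-(i : ℤ)))) *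
        (∏ i ∈ Finset.Icc 1 (s - r), (1 - (q : ℝ) ^ (-(i : ℤ)))⁻¹))) := by
  subst hq
  have hq := RandomDBT.one_lt_card_real (k := k)
  have hq0 : (0 : ℝ) < Nat.card k := zero_lt_one.trans hq
  have hz : ∀ n : ℕ, (Nat.card k : ℝ) ^ (-(n : ℤ)) = (Nat.card k : ℝ)⁻¹ ^ n := fun n => by
    rw [zpow_neg, zpow_natCast, inv_pow]
  have hz1 : ∀ n : ℕ, (Nat.card k : ℝ) ^ (-((n : ℤ) + 1)) = (Nat.card k : ℝ)⁻¹ ^ (n + 1) := fun n => by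
    rw [← hz]
    push_cast
    rfl
  have hc : (Nat.card k : ℝ) ^ (-(((r + 1).choose 2 : ℕ) : ℤ) + (r : ℤ) - (s : ℤ)) =
      (Nat.card k : ℝ)⁻¹ ^ (r + 1).choose 2 * (Nat.card k : ℝ)⁻¹ ^ (s - r) := by
    rw [← pow_add, ← hz]
    congr 1
    push_cast [Nat.cast_sub hrs]
    ring
  have hm := RandomDBT.multipliable_inv_one_add (inv_pos.2 hq0) (inv_lt_one_of_one_lt₀ hq)
  simp only [hz1, hz, hc]
  refine ⟨hm, ?_⟩
  have hlim := (hm.hasProd.tendsto_prod_nat.const_mul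
    ((Nat.card k : ℝ)⁻¹ ^ (r + 1).choose 2)).mul_const (RandomDBT.phi (Nat.card k : ℝ)⁻¹ r s)
  have heq : ∀ a b c d e : ℝ, a * b * c * d * e = a * c * (b * d * e) := fun a b c d e => by ring
  rw [heq]
  refine hlim.congr' ?_
  filter_upwards [Filter.eventually_ge_atTop s] with g hg
  exact (RandomDBT.prob_formula hrs hg (M₀ g)).symm
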